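/- Corollary 5.2. Let $n \ge 0$ and let $M$ be a non-empty compact smooth manifold (Hausdorff, without boundary, not necessarily connected) of real dimension $4n$ that admits a complex symplectic structure, that is, a pair $(J,\omega_{\mathbb C})$ in which $J$ is a complex structure on $M$ (a smooth endomorphism of $TM$ with $J^2=-\mathrm{Id}$ and $[JX,JY]=[X,Y]+J[JX,Y]+J[X,JY]$ for all smooth vector fields $X,Y$) and $\omega_{\mathbb C}\in\Omega^2(M,\mathbb C)$ is a closed $2$-form of bidegree $(2,0)$ with respect to $J$ that is non-degenerate (if $v\in T_xM$ and $\omega_{\mathbb C}(v,w)=0$ for all $w\in T_xM$, then $v=0$). Let $b_j(M)=\dim_{\mathbb R}H^j_{\mathrm{dR}}(M;\mathbb R)$ denote the Betti numbers of $M$. Then $$b_{2k}(M)\ \ge\ k+1 \quad (k=1,\dots,n), \qquad b_{2l}(M)\ \ge\ 2n-l+1 \quad (l=n+1,\dots,2n-1).$$ -/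

import Mathlib

open scoped Manifold ContDiff Topology
open Set VectorField

noncomputable section

namespace SmoothForms

universe uE uM uF

section Pullback

variable {E : Type uE} [NormedAddCommGroup E] [NormedSpace ℝ E]
  {M : Type uM} [TopologicalSpace M] [ChartedSpace E M]
  {F : Type uF} [NormedAddCommGroup F] [NormedSpace ℝ F] {k : ℕ}

variable (E M F k) in
/-- Not necessarily continuous differential `k`-forms with values in `F` on a manifold `M`
modelled on `E`: an alternating `ℝ`-multilinear map on each tangent space. -/
abbrev FormField : Type _ :=
  ∀ x : M, TangentSpace 𝓘(ℝ, E) x [⋀^Fin k]→L[ℝ] F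

/-- The pullback of a form by the inverse of the chart at `x₀`; it is meaningful
on the target of this chart. -/
def inChart (α : FormField E M F k) (x₀ : M) (y : E) : E [⋀^Fin k]→L[ℝ] F :=
  (α ((chartAt E x₀).symm y)).compContinuousLinearMap
    (mfderiv 𝓘(ℝ, E) 𝓘(ℝ, E) (chartAt E x₀).symm y)

/-- A form is smooth if it is smooth in every chart. -/
def IsSmoothForm (α : FormField E M F k) : Prop :=
  ∀ x₀ : M, ContDiffOn ℝ ∞ (inChart α x₀) (chartAt E x₀).target

/-- The exterior derivative of a form, at `x`: take the exterior derivative in the chart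
at `x`, and pull it back to `M` by this chart. -/
def extD (α : FormField E M F k) : FormField E M F (k + 1) := fun x =>
  (extDeriv (inChart α x) (chartAt E x x)).compContinuousLinearMap
    (mfderiv 𝓘(ℝ, E) 𝓘(ℝ, E) (chartAt E x) x)

theorem minSmoothness_le_infty : minSmoothness ℝ 2 ≤ ∞ := by
  rw [minSmoothness_of_isRCLikeNormedField]
  exact (mod_cast le_top : ((2 : ℕ∞) : WithTop ℕ∞) ≤ ((⊤ : ℕ∞) : WithTop ℕ∞))

theorem inChart_add (α β : FormField E M F k) (x₀ : M) :
    inChart (α + β) x₀ = inChart α x₀ + inChart β x₀ := by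
  ext y v; rfl

theorem inChart_smul (c : ℝ) (α : FormField E M F k) (x₀ : M) :
    inChart (c • α) x₀ = c • inChart α x₀ := by
  ext y v; rfl

theorem inChart_zero (x₀ : M) : inChart (0 : FormField E M F k) x₀ = 0 := by
  ext y v; rfl

theorem IsSmoothForm.differentiableAt {α : FormField E M F k} (hα : IsSmoothForm α) {x₀ : M}
    {y : E} (hy : y ∈ (chartAt E x₀).target) : DifferentiableAt ℝ (inChart α x₀) y :=
  ((hα x₀).contDiffAt ((chartAt E x₀).open_target.mem_nhds hy)).differentiableAt (by simp)

/-- The form in the chart at `x₀` is the pullback, by the change of charts, of the form in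
the chart at `x`. -/
theorem inChart_eq_pullback [IsManifold 𝓘(ℝ, E) ∞ M] (α : FormField E M F k) (x₀ x : M) {z : E}
    (hz : z ∈ (chartAt E x₀).target) (hz' : (chartAt E x₀).symm z ∈ (chartAt E x).source) :
    inChart α x₀ z =
      (inChart α x (((chartAt E x) ∘ (chartAt E x₀).symm) z)).compContinuousLinearMap
        (fderiv ℝ ((chartAt E x) ∘ (chartAt E x₀).symm) z) := by
  have : IsManifold 𝓘(ℝ, E) 1 M := .of_le (n := ∞) (by simp)
  have h0 : MDifferentiableAt 𝓘(ℝ, E) 𝓘(ℝ, E) (chartAt E x₀).symm z :=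
    mdifferentiableAt_atlas_symm (chart_mem_atlas E x₀) hz
  have h1 : MDifferentiableAt 𝓘(ℝ, E) 𝓘(ℝ, E) (chartAt E x) ((chartAt E x₀).symm z) :=
    mdifferentiableAt_atlas (chart_mem_atlas E x) hz'
  have hfd : fderiv ℝ ((chartAt E x) ∘ (chartAt E x₀).symm) z =
      (mfderiv 𝓘(ℝ, E) 𝓘(ℝ, E) (chartAt E x) ((chartAt E x₀).symm z)).comp
        (mfderiv 𝓘(ℝ, E) 𝓘(ℝ, E) (chartAt E x₀).symm z) := by
    rw [← mfderiv_eq_fderiv]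
    exact mfderiv_comp z h1 h0
  have hinv := (mdifferentiable_chart (I := 𝓘(ℝ, E)) x).symm_comp_deriv hz'
  have hleft : (chartAt E x).symm ((chartAt E x) ((chartAt E x₀).symm z)) =
      (chartAt E x₀).symm z := (chartAt E x).left_inv hz'
  have key : ∀ (p q : M) (A : E →L[ℝ] E), p = q →
      (show E [⋀^Fin k]→L[ℝ] F from α p).compContinuousLinearMap A =
      (show E [⋀^Fin k]→L[ℝ] F from α q).compContinuousLinearMap A := by
    rintro p _ A rfl; rfl
  rw [hfd]
  refine Eq.trans ?_ (key _ _ ((mfderiv 𝓘(ℝ, E) 𝓘(ℝ, E) (chartAt E x).symm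
      ((chartAt E x) ((chartAt E x₀).symm z))).comp
      ((mfderiv 𝓘(ℝ, E) 𝓘(ℝ, E) (chartAt E x) ((chartAt E x₀).symm z)).comp
        (mfderiv 𝓘(ℝ, E) 𝓘(ℝ, E) (chartAt E x₀).symm z))) hleft).symm
  ext v
  refine congrArg (α ((chartAt E x₀).symm z)) ?_
  funext i
  exact (DFunLike.congr_fun hinv
    ((mfderiv 𝓘(ℝ, E) 𝓘(ℝ, E) (chartAt E x₀).symm z) (v i))).symm

theorem contDiffAt_chartChange [IsManifold 𝓘(ℝ, E) ∞ M] (x₀ x : M) {z : E}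
    (hz : z ∈ (chartAt E x₀).target) (hz' : (chartAt E x₀).symm z ∈ (chartAt E x).source) :
    ContDiffAt ℝ ∞ ((chartAt E x) ∘ (chartAt E x₀).symm) z := by
  have h0 : ContMDiffAt 𝓘(ℝ, E) 𝓘(ℝ, E) ∞ (chartAt E x₀).symm z :=
    (contMDiffOn_chart_symm (x := x₀)).contMDiffAt ((chartAt E x₀).open_target.mem_nhds hz)
  have h1 : ContMDiffAt 𝓘(ℝ, E) 𝓘(ℝ, E) ∞ (chartAt E x) ((chartAt E x₀).symm z) :=
    (contMDiffOn_chart (x := x)).contMDiffAt ((chartAt E x).open_source.mem_nhds hz')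
  exact (h1.comp z h0).contDiffAt

/-- The exterior derivative is computed in every chart by the same formula. -/
theorem inChart_extD [IsManifold 𝓘(ℝ, E) ∞ M] {α : FormField E M F k} (hα : IsSmoothForm α)
    (x₀ : M) {y : E} (hy : y ∈ (chartAt E x₀).target) :
    inChart (extD α) x₀ y = extDeriv (inChart α x₀) y := by
  have : IsManifold 𝓘(ℝ, E) 1 M := .of_le (n := ∞) (by simp)
  set x := (chartAt E x₀).symm y with hx
  have hxs : x ∈ (chartAt E x).source := mem_chart_source E x
  have h0 : MDifferentiableAt 𝓘(ℝ, E) 𝓘(ℝ, E) (chartAt E x₀).symm y :=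
    mdifferentiableAt_atlas_symm (chart_mem_atlas E x₀) hy
  have h1 : MDifferentiableAt 𝓘(ℝ, E) 𝓘(ℝ, E) (chartAt E x) ((chartAt E x₀).symm y) :=
    mdifferentiableAt_atlas (chart_mem_atlas E x) hxs
  have hfd : fderiv ℝ ((chartAt E x) ∘ (chartAt E x₀).symm) y =
      (mfderiv 𝓘(ℝ, E) 𝓘(ℝ, E) (chartAt E x) x).comp
        (mfderiv 𝓘(ℝ, E) 𝓘(ℝ, E) (chartAt E x₀).symm y) := by
    rw [← mfderiv_eq_fderiv]
    exact mfderiv_comp y h1 h0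
  have hev : inChart α x₀ =ᶠ[𝓝 y] fun z =>
      (inChart α x (((chartAt E x) ∘ (chartAt E x₀).symm) z)).compContinuousLinearMap
        (fderiv ℝ ((chartAt E x) ∘ (chartAt E x₀).symm) z) := by
    filter_upwards [(chartAt E x₀).open_target.mem_nhds hy,
      ((chartAt E x₀).continuousAt_symm hy).preimage_mem_nhds
        ((chartAt E x).open_source.mem_nhds hxs)] with z hz hz'
    exact inChart_eq_pullback α x₀ x hz hz'
  have hd : DifferentiableAt ℝ (inChart α x) (((chartAt E x) ∘ (chartAt E x₀).symm) y) :=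
    hα.differentiableAt ((chartAt E x).map_source hxs)
  have hpb := extDeriv_pullback (r := ∞) hd (contDiffAt_chartChange x₀ x hy hxs)
    minSmoothness_le_infty
  rw [hev.extDeriv_eq, hpb, hfd]
  rfl

theorem IsSmoothForm.extD [IsManifold 𝓘(ℝ, E) ∞ M] {α : FormField E M F k}
    (hα : IsSmoothForm α) : IsSmoothForm (extD α) := by
  intro x₀
  have h : ContDiffOn ℝ ∞ (extDeriv (inChart α x₀)) (chartAt E x₀).target :=
    (ContinuousAlternatingMap.alternatizeUncurryFinCLM ℝ E F).contDiff.comp_contDiffOn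
      ((hα x₀).fderiv_of_isOpen (chartAt E x₀).open_target (by simp))
  exact h.congr fun y hy => inChart_extD hα x₀ hy

theorem extD_extD [IsManifold 𝓘(ℝ, E) ∞ M] {α : FormField E M F k} (hα : IsSmoothForm α) :
    SmoothForms.extD (SmoothForms.extD α) = 0 := by
  funext x
  have hx : chartAt E x x ∈ (chartAt E x).target := mem_chart_target E x
  have hev : inChart (SmoothForms.extD α) x =ᶠ[𝓝 (chartAt E x x)] extDeriv (inChart α x) := by
    filter_upwards [(chartAt E x).open_target.mem_nhds hx] with y hy
    exact inChart_extD hα x hy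
  have h2 : extDeriv (inChart (SmoothForms.extD α) x) (chartAt E x x) = 0 := by
    rw [hev.extDeriv_eq]
    exact extDeriv_extDeriv_apply (r := ∞)
      ((hα x).contDiffAt ((chartAt E x).open_target.mem_nhds hx))
      minSmoothness_le_infty
  unfold SmoothForms.extD at h2 ⊢
  rw [h2]
  rfl

variable (E M F k) in
/-- The smooth forms, as a subspace of all forms. -/
def smoothForms : Submodule ℝ (FormField E M F k) where
  carrier := {α | IsSmoothForm α}
  add_mem' ha hb x₀ := by rw [inChart_add]; exact (ha x₀).add (hb x₀)
  zero_mem' x₀ := by rw [inChart_zero]; exact contDiffOn_const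
  smul_mem' c a ha x₀ := by rw [inChart_smul]; exact contDiffOn_const.smul (ha x₀)

variable (E M F k) in
/-- The space `Ω^k(M; F)` of smooth `F`-valued `k`-forms. -/
def SmoothForm : Type _ := smoothForms E M F k

instance : AddCommGroup (SmoothForm E M F k) := inferInstanceAs (AddCommGroup (smoothForms E M F k))

instance : Module ℝ (SmoothForm E M F k) := inferInstanceAs (Module ℝ (smoothForms E M F k))

variable (E M F k) in
/-- The exterior derivative `d : Ω^k(M; F) → Ω^{k+1}(M; F)`. -/
def d [IsManifold 𝓘(ℝ, E) ∞ M] : SmoothForm E M F k →ₗ[ℝ] SmoothForm E M F (k + 1) where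
  toFun α := ⟨extD α.1, IsSmoothForm.extD α.2⟩
  map_add' a b := by
    refine Subtype.ext ?_
    funext x
    have hx : chartAt E x x ∈ (chartAt E x).target := mem_chart_target E x
    change (extDeriv (inChart (a.1 + b.1) x) _).compContinuousLinearMap _ = _
    rw [inChart_add, extDeriv_add (IsSmoothForm.differentiableAt a.2 hx)
      (IsSmoothForm.differentiableAt b.2 hx)]
    rfl
  map_smul' c a := by
    refine Subtype.ext ?_
    funext x
    change (extDeriv (inChart (c • a.1) x) _).compContinuousLinearMap _ = _
    rw [inChart_smul, extDeriv_smul]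
    rfl

theorem d_d [IsManifold 𝓘(ℝ, E) ∞ M] (α : SmoothForm E M F k) :
    d E M F (k + 1) (d E M F k α) = 0 :=
  Subtype.ext (extD_extD α.2)

variable (E M F) in
/-- The exact `k`-forms. -/
def exactForms [IsManifold 𝓘(ℝ, E) ∞ M] : ∀ k : ℕ, Submodule ℝ (SmoothForm E M F k)
  | 0 => ⊥
  | k + 1 => LinearMap.range (d E M F k)

variable (E M F k) in
/-- The de Rham cohomology `H^k_dR(M; F)`: closed `k`-forms modulo exact `k`-forms. -/
abbrev DeRhamCohomology [IsManifold 𝓘(ℝ, E) ∞ M] : Type _ :=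
  LinearMap.ker (d E M F k) ⧸
    (exactForms E M F k).comap (LinearMap.ker (d E M F k)).subtype

variable (E M k) in
/-- The `k`-th Betti number, `dim_ℝ H^k_dR(M; ℝ)`, as a cardinal. -/
def bettiNumber [IsManifold 𝓘(ℝ, E) ∞ M] : Cardinal :=
  Module.rank ℝ (DeRhamCohomology E M ℝ k)

end Pullback

section ComplexStructure

variable {V : Type uE} [AddCommGroup V] [Module ℝ V] [TopologicalSpace V]

/-- The real-linear functionals `λ : V → ℂ` with `λ ∘ J = c λ`: for `c = i` these are the
covectors of type `(1, 0)`, for `c = -i` those of type `(0, 1)`. -/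
def IsEigenCovector (J : V →L[ℝ] V) (c : ℂ) (l : V →L[ℝ] ℂ) : Prop :=
  ∀ v, l (J v) = c * l v

variable [IsTopologicalAddGroup V] [ContinuousSMul ℝ V]

/-- The space `Λ^{p,q}` of complex covectors of bidegree `(p, q)` with respect to a linear
complex structure `J`: the complex span of the wedge products
`l₁ ∧ ⋯ ∧ l_{p+q}`, `(v₁, …, v_{p+q}) ↦ det (lᵢ(vⱼ))`, of `p` covectors of type `(1, 0)` and
`q` covectors of type `(0, 1)`. -/
def bidegree (J : V →L[ℝ] V) (p q : ℕ) : Submodule ℂ (V [⋀^Fin (p + q)]→L[ℝ] ℂ) :=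
  Submodule.span ℂ {α | ∃ l : Fin (p + q) → V →L[ℝ] ℂ,
    (∀ i : Fin (p + q), (i : ℕ) < p → IsEigenCovector J Complex.I (l i)) ∧
    (∀ i : Fin (p + q), p ≤ (i : ℕ) → IsEigenCovector J (-Complex.I) (l i)) ∧
    ∀ v, α v = (Matrix.of fun i j => l i (v j)).det}

end ComplexStructure

section ComplexSymplectic

variable {E : Type uE} [NormedAddCommGroup E] [NormedSpace ℝ E]
  {M : Type uM} [TopologicalSpace M] [ChartedSpace E M] [IsManifold 𝓘(ℝ, E) ∞ M]

/-- Smooth vector fields. -/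
def IsSmoothVectorField (X : ∀ x : M, TangentSpace 𝓘(ℝ, E) x) : Prop :=
  ContMDiff 𝓘(ℝ, E) 𝓘(ℝ, E).tangent ∞ fun x => (⟨x, X x⟩ : TangentBundle 𝓘(ℝ, E) M)

variable (E M) in
/-- A complex structure on the smooth manifold `M`: a smooth endomorphism `J` of the tangent
bundle with `J² = -Id` that is integrable, that is
`[JX, JY] = [X, Y] + J[JX, Y] + J[X, JY]` for all smooth vector fields `X`, `Y`. -/
structure ComplexStructure where
  toFun : ∀ x : M, TangentSpace 𝓘(ℝ, E) x →L[ℝ] TangentSpace 𝓘(ℝ, E) x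
  smooth : ContMDiff 𝓘(ℝ, E) (𝓘(ℝ, E).prod 𝓘(ℝ, E →L[ℝ] E)) ∞ fun x =>
    Bundle.TotalSpace.mk' (E →L[ℝ] E)
      (E := fun x : M => TangentSpace 𝓘(ℝ, E) x →L[ℝ] TangentSpace 𝓘(ℝ, E) x) x (toFun x)
  sq : ∀ x v, toFun x (toFun x v) = -v
  integrable : ∀ X Y : (∀ x : M, TangentSpace 𝓘(ℝ, E) x),
    IsSmoothVectorField X → IsSmoothVectorField Y → ∀ x,
      mlieBracket 𝓘(ℝ, E) (fun y => toFun y (X y)) (fun y => toFun y (Y y)) x =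
        mlieBracket 𝓘(ℝ, E) X Y x
        + toFun x (mlieBracket 𝓘(ℝ, E) (fun y => toFun y (X y)) Y x)
        + toFun x (mlieBracket 𝓘(ℝ, E) X (fun y => toFun y (Y y)) x)

variable (E M) in
/-- A complex symplectic structure `(J, σ)` on `M`: a complex structure `J` and a closed smooth
complex `2`-form `σ` of bidegree `(2, 0)` with respect to `J` that is non-degenerate: the only
tangent vector `v` with `σ(v, ·) = 0` is `0`. -/
structure ComplexSymplecticStructure where
  J : ComplexStructure E M
  form : SmoothForm E M ℂ 2
  closed : d E M ℂ 2 form = 0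
  bidegree : ∀ x, form.1 x ∈ bidegree (J.toFun x) 2 0
  nondegenerate : ∀ x (v : TangentSpace 𝓘(ℝ, E) x), (∀ w, form.1 x ![v, w] = 0) → v = 0

end ComplexSymplectic

end SmoothForms

end

/-! Write `σ` for the symplectic form. In degree `2k` the closed forms `σ^i ∧ conj σ^j` with `i + j
= k` and `i, j ≤ n` are linearly independent in complex cohomology. Counting the pairs `(i, j)`
gives `k + 1` for `k ≤ n` and `2n - k + 1` for `k ≥ n`.

Independence rests on three facts. Since `σ` has type `(2, 0)`, `σ^(n+1) = 0`, and likewise for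
`conj σ` (`lefschetz_pow_eq_zero`). Since `σ` is closed, multiplication by powers of `σ` and `conj
σ` commutes with `d` and so preserves exactness (`extDeriv_wedge2`, `lefschetzField_pow`). Finally
`σ^n ∧ conj σ^n` is not exact: `(σ + conj σ)^(2n)` equals `(2n).choose n` times it, because all
other binomial terms vanish. This power of a non-degenerate real `2`-form is a volume form
(`lefschetz_pow_ne_zero`), and Stokes' theorem excludes a primitive (`extD_ne_of_forall_ne_zero`).

Suppose a combination of the `σ^i ∧ conj σ^j` is exact. Multiplying by `σ^(n - i₀) ∧ conj σ^(n -
j₀)` kills every term except that of `(i₀, j₀)`, which becomes a multiple of `σ^n ∧ conj σ^n`. Its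
coefficient is therefore zero.

Betti numbers are real dimensions, so the argument is run on the real parts of `(1 + i) σ^i ∧ conj
σ^j`. The factor `1 + i` lets one uniform family, indexed by all pairs, stay independent over `ℝ`
although conjugation exchanges `(i, j)` and `(j, i)` (`ofReal_sum_realPower`). -/

noncomputable section

namespace SmoothForms

set_option maxSynthPendingDepth 3

open ContinuousAlternatingMap (alternatizeUncurryFin alternatizeUncurryFinCLM
  alternatizeUncurryFin_apply alternatizeUncurryFin_add alternatizeUncurryFin_smul
  alternatizeUncurryFinCLM_apply compContinuousLinearMap_apply ofSubsingletonLIE curryLeftLI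
  alternatizeUncurryFin_alternatizeUncurryFinCLM_comp_of_symmetric)

/-! ### Wedge products with covectors and with 2-forms on a vector space -/

section WedgeOperators

variable {V : Type*} [NormedAddCommGroup V] [NormedSpace ℝ V]
  {A : Type*} [NormedAddCommGroup A] [NormedSpace ℝ A] {k m : ℕ}

/-- Given a bilinear map `c`, the bilinear map sending `f : V → A` and `β` to the alternatization
of `v ↦ c (f v) β`. -/
def alternatizeBilin (c : A →L[ℝ] (V [⋀^Fin k]→L[ℝ] ℂ) →L[ℝ] (V [⋀^Fin m]→L[ℝ] ℂ)) :
    (V →L[ℝ] A) →L[ℝ] (V [⋀^Fin k]→L[ℝ] ℂ) →L[ℝ] (V [⋀^Fin (m + 1)]→L[ℝ] ℂ) :=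
  ((ContinuousLinearMap.compL ℝ (V [⋀^Fin k]→L[ℝ] ℂ) (V →L[ℝ] (V [⋀^Fin m]→L[ℝ] ℂ))
      (V [⋀^Fin (m + 1)]→L[ℝ] ℂ) (alternatizeUncurryFinCLM ℝ V ℂ)) ∘L
    (ContinuousLinearMap.flipₗᵢ ℝ V (V [⋀^Fin k]→L[ℝ] ℂ)
      (V [⋀^Fin m]→L[ℝ] ℂ)).toContinuousLinearEquiv.toContinuousLinearMap ∘L
    (ContinuousLinearMap.compL ℝ V A ((V [⋀^Fin k]→L[ℝ] ℂ) →L[ℝ] (V [⋀^Fin m]→L[ℝ] ℂ)) c))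

theorem alternatizeBilin_apply
    (c : A →L[ℝ] (V [⋀^Fin k]→L[ℝ] ℂ) →L[ℝ] (V [⋀^Fin m]→L[ℝ] ℂ)) (f : V →L[ℝ] A)
    (β : V [⋀^Fin k]→L[ℝ] ℂ) :
    alternatizeBilin c f β = alternatizeUncurryFin ((c.flip β) ∘L f) := rfl

variable (V k) in
/-- The wedge product with a complex covector. -/
def wedge1 : (V →L[ℝ] ℂ) →L[ℝ] (V [⋀^Fin k]→L[ℝ] ℂ) →L[ℝ] (V [⋀^Fin (k + 1)]→L[ℝ] ℂ) :=
  alternatizeBilin (ContinuousLinearMap.lsmul ℝ ℂ)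

variable (V k) in
/-- Twice the wedge product with the `2`-form given by a bilinear form. -/
def wedge2 : (V →L[ℝ] V →L[ℝ] ℂ) →L[ℝ]
    (V [⋀^Fin k]→L[ℝ] ℂ) →L[ℝ] (V [⋀^Fin (k + 2)]→L[ℝ] ℂ) :=
  alternatizeBilin (wedge1 V k)

theorem wedge1_apply (l : V →L[ℝ] ℂ) (β : V [⋀^Fin k]→L[ℝ] ℂ) (v : Fin (k + 1) → V) :
    wedge1 V k l β v = ∑ i : Fin (k + 1), (-1) ^ (i : ℕ) • (l (v i) * β (i.removeNth v)) := by
  rw [wedge1, alternatizeBilin_apply, alternatizeUncurryFin_apply]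
  rfl

theorem wedge2_apply (b : V →L[ℝ] V →L[ℝ] ℂ) (β : V [⋀^Fin k]→L[ℝ] ℂ) (v : Fin (k + 2) → V) :
    wedge2 V k b β v =
      ∑ i : Fin (k + 2), (-1) ^ (i : ℕ) • (wedge1 V k (b (v i)) β (i.removeNth v)) := by
  rw [wedge2, alternatizeBilin_apply, alternatizeUncurryFin_apply]
  rfl

theorem wedge1_smul (c : ℂ) (l : V →L[ℝ] ℂ) (β : V [⋀^Fin k]→L[ℝ] ℂ) :
    wedge1 V k l (c • β) = c • wedge1 V k l β := by
  ext v
  simp only [wedge1_apply, ContinuousAlternatingMap.smul_apply, smul_eq_mul, Finset.mul_sum]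
  refine Finset.sum_congr rfl fun i _ => ?_
  rw [mul_smul_comm]
  congr 1; ring

theorem wedge1_smul_left (c : ℂ) (l : V →L[ℝ] ℂ) (β : V [⋀^Fin k]→L[ℝ] ℂ) :
    wedge1 V k (c • l) β = c • wedge1 V k l β := by
  rw [← wedge1_smul]
  ext v
  simp only [wedge1_apply, ContinuousAlternatingMap.smul_apply, _root_.smul_apply,
    smul_eq_mul]
  refine Finset.sum_congr rfl fun i _ => ?_
  congr 1; ring

theorem wedge2_smul (c : ℂ) (b : V →L[ℝ] V →L[ℝ] ℂ) (β : V [⋀^Fin k]→L[ℝ] ℂ) :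
    wedge2 V k b (c • β) = c • wedge2 V k b β := by
  ext v
  simp only [wedge2_apply, ContinuousAlternatingMap.smul_apply, Finset.smul_sum, wedge1_smul]
  exact Finset.sum_congr rfl fun i _ => smul_comm _ _ _

/-- Covectors anticommute. -/
theorem wedge1_wedge1 (l l' : V →L[ℝ] ℂ) (β : V [⋀^Fin k]→L[ℝ] ℂ) :
    wedge1 V _ l (wedge1 V _ l' β) = - wedge1 V _ l' (wedge1 V _ l β) := by
  let G : (V →L[ℝ] ℂ) → V →L[ℝ] (V [⋀^Fin k]→L[ℝ] ℂ) := fun l' =>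
    (ContinuousLinearMap.lsmul ℝ ℂ).flip β ∘L l'
  let B : (V →L[ℝ] ℂ) → (V →L[ℝ] ℂ) → V →L[ℝ] V →L[ℝ] (V [⋀^Fin k]→L[ℝ] ℂ) := fun l l' =>
    ContinuousLinearMap.compL ℝ V ℂ (V [⋀^Fin k]→L[ℝ] ℂ)
        ((ContinuousLinearMap.lsmul ℝ ℂ).flip β) ∘L
      ((ContinuousLinearMap.compL ℝ V ℂ ℂ).flip l' ∘L ContinuousLinearMap.mul ℝ ℂ ∘L l)
  have hB (l l' : V →L[ℝ] ℂ) : wedge1 V _ l (wedge1 V _ l' β) =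
      alternatizeUncurryFin (alternatizeUncurryFinCLM ℝ V ℂ ∘L B l l') := by
    rw [wedge1, alternatizeBilin_apply]
    congr 1
    ext1 u
    refine (alternatizeUncurryFin_smul (l u) (G l')).symm.trans ?_
    change _ = alternatizeUncurryFin (B l l' u)
    congr 1
    ext1 w
    exact smul_smul (l u) (l' w) β
  -- The sum of the two products is the double alternatization of a bilinear map symmetric in its
  -- two arguments, hence zero.
  rw [hB, hB, eq_neg_iff_add_eq_zero, ← alternatizeUncurryFin_add, ← ContinuousLinearMap.comp_add]
  refine alternatizeUncurryFin_alternatizeUncurryFinCLM_comp_of_symmetric fun x y => ?_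
  change (l x * l' y) • β + (l' x * l y) • β = (l y * l' x) • β + (l' y * l x) • β
  rw [add_comm, mul_comm (l' x), mul_comm (l x)]

theorem wedge1_compContinuousLinearMap {W : Type*} [NormedAddCommGroup W] [NormedSpace ℝ W]
    (l : V →L[ℝ] ℂ) (β : V [⋀^Fin k]→L[ℝ] ℂ) (T : W →L[ℝ] V) :
    (wedge1 V k l β).compContinuousLinearMap T =
      wedge1 W k (l ∘L T) (β.compContinuousLinearMap T) := by
  ext v
  simp only [wedge1_apply, compContinuousLinearMap_apply]
  rfl

theorem wedge2_compContinuousLinearMap {W : Type*} [NormedAddCommGroup W] [NormedSpace ℝ W]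
    (b : V →L[ℝ] V →L[ℝ] ℂ) (β : V [⋀^Fin k]→L[ℝ] ℂ) (T : W →L[ℝ] V) :
    (wedge2 V k b β).compContinuousLinearMap T =
      wedge2 W k (b.bilinearComp T T) (β.compContinuousLinearMap T) := by
  ext v
  simp only [wedge2_apply, compContinuousLinearMap_apply]
  refine Finset.sum_congr rfl fun i _ => ?_
  congr 1
  exact congrArg (fun f => f (i.removeNth v))
    (wedge1_compContinuousLinearMap (b (T (v i))) β T)

/-- The complex conjugate of a form. -/
def conjForm (β : V [⋀^Fin k]→L[ℝ] ℂ) : V [⋀^Fin k]→L[ℝ] ℂ :=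
  (Complex.conjCLE : ℂ →L[ℝ] ℂ).compContinuousAlternatingMap β

theorem conjForm_apply (β : V [⋀^Fin k]→L[ℝ] ℂ) (v : Fin k → V) :
    conjForm β v = starRingEnd ℂ (β v) := rfl

theorem conjForm_wedge1 (l : V →L[ℝ] ℂ) (β : V [⋀^Fin k]→L[ℝ] ℂ) :
    conjForm (wedge1 V k l β) =
      wedge1 V k ((Complex.conjCLE : ℂ →L[ℝ] ℂ) ∘L l) (conjForm β) := by
  ext v
  simp only [wedge1_apply, conjForm_apply, map_sum]
  refine Finset.sum_congr rfl fun i _ => ?_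
  rw [map_zsmul, map_mul]
  rfl

theorem conjForm_wedge2 (b : V →L[ℝ] V →L[ℝ] ℂ) (β : V [⋀^Fin k]→L[ℝ] ℂ) :
    conjForm (wedge2 V k b β) = wedge2 V k
      ((ContinuousLinearMap.compL ℝ V ℂ ℂ (Complex.conjCLE : ℂ →L[ℝ] ℂ)) ∘L b) (conjForm β) := by
  ext v
  simp only [wedge2_apply, conjForm_apply, map_sum]
  refine Finset.sum_congr rfl fun i _ => ?_
  rw [map_zsmul, ← conjForm_apply, conjForm_wedge1]
  rfl

/-- The bilinear form of a `2`-form. -/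
def curry2 : (V [⋀^Fin 2]→L[ℝ] ℂ) →L[ℝ] V →L[ℝ] V →L[ℝ] ℂ :=
  ContinuousLinearMap.compL ℝ V (V [⋀^Fin 1]→L[ℝ] ℂ) (V →L[ℝ] ℂ)
      ((ofSubsingletonLIE (𝕜 := ℝ) (E := V) (F := ℂ) (0 : Fin 1)).symm.toContinuousLinearEquiv.toContinuousLinearMap)
    ∘L (curryLeftLI (𝕜 := ℝ) (E := V) (F := ℂ) (n := 1)).toContinuousLinearMap

theorem curry2_apply (s : V [⋀^Fin 2]→L[ℝ] ℂ) (u v : V) : curry2 s u v = s ![u, v] := by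
  change s (Matrix.vecCons u fun _ => v) = _
  congr 1
  ext i; fin_cases i <;> rfl

theorem curry2_swap (s : V [⋀^Fin 2]→L[ℝ] ℂ) (u v : V) : curry2 s u v = - curry2 s v u := by
  rw [curry2_apply, curry2_apply, ← s.coe_toAlternatingMap,
    ← AlternatingMap.map_swap _ ![v, u] (show (0 : Fin 2) ≠ 1 by decide)]
  congr 1
  ext i; fin_cases i <;> simp

theorem curry2_compContinuousLinearMap {W : Type*} [NormedAddCommGroup W] [NormedSpace ℝ W]
    (s : V [⋀^Fin 2]→L[ℝ] ℂ) (T : W →L[ℝ] V) :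
    curry2 (s.compContinuousLinearMap T) = (curry2 s).bilinearComp T T := by
  ext u v
  rw [ContinuousLinearMap.bilinearComp_apply, curry2_apply, curry2_apply,
    compContinuousLinearMap_apply]
  congr 1
  ext i; fin_cases i <;> rfl

theorem curry2_conjForm (s : V [⋀^Fin 2]→L[ℝ] ℂ) :
    curry2 (conjForm s) =
      (ContinuousLinearMap.compL ℝ V ℂ ℂ (Complex.conjCLE : ℂ →L[ℝ] ℂ)) ∘L curry2 s := by
  ext u v
  rw [curry2_apply, conjForm_apply, ← curry2_apply]
  rfl

/-- Closedness of a `2`-form in coordinates, in the cyclic shape consumed by `sum_cyclic_eq_zero`.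
-/
theorem fderiv_cyclic {s : V → V [⋀^Fin 2]→L[ℝ] ℂ} {y : V} (hd : extDeriv s y = 0) (u v w : V) :
    fderiv ℝ s y u ![v, w] + fderiv ℝ s y v ![w, u] + fderiv ℝ s y w ![u, v] = 0 := by
  have h := congrArg (fun f => f ![u, v, w]) hd
  rw [extDeriv, alternatizeUncurryFin_apply, Fin.sum_univ_three] at h
  have h0 : Fin.removeNth 0 ![u, v, w] = ![v, w] := by
    ext i; fin_cases i <;> rfl
  have h1 : Fin.removeNth 1 ![u, v, w] = ![u, w] := by
    ext i; fin_cases i <;> rfl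
  have h2 : Fin.removeNth 2 ![u, v, w] = ![u, v] := by
    ext i; fin_cases i <;> rfl
  rw [h0, h1, h2, ← curry2_apply _ u w, curry2_swap, curry2_apply] at h
  simpa using h

theorem sum_rotate {ι X : Type*} [Fintype ι] [AddCommMonoid X] (f : ι → ι → ι → X) :
    ∑ a, ∑ b, ∑ c, f b c a = ∑ a, ∑ b, ∑ c, f a b c := by
  rw [Finset.sum_comm]
  exact Finset.sum_congr rfl fun b _ => Finset.sum_comm

/-- Averaging over cyclic permutations: three times the sum pairs `Q` with the cyclic sums of `T`.
-/
theorem sum_cyclic_eq_zero {ι X : Type*} [Fintype ι] [AddCommGroup X] [Module ℂ X]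
    (T : ι → ι → ι → ℂ) (Q : ι → ι → ι → X) (hT : ∀ a b c, T a b c + T b c a + T c a b = 0)
    (hQ : ∀ a b c, Q b c a = Q a b c) : ∑ a, ∑ b, ∑ c, T a b c • Q a b c = 0 := by
  have h1 : ∑ a, ∑ b, ∑ c, T b c a • Q a b c = ∑ a, ∑ b, ∑ c, T a b c • Q a b c := by
    rw [← sum_rotate fun a b c => T a b c • Q a b c]
    simp only [hQ]
  have h2 : ∑ a, ∑ b, ∑ c, T c a b • Q a b c = ∑ a, ∑ b, ∑ c, T a b c • Q a b c := by
    rw [← h1, ← sum_rotate fun a b c => T b c a • Q a b c]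
    simp only [hQ]
  have h3 : (3 : ℂ) • ∑ a, ∑ b, ∑ c, T a b c • Q a b c =
      ∑ a, ∑ b, ∑ c, (T a b c + T b c a + T c a b) • Q a b c := by
    simp only [add_smul, Finset.sum_add_distrib]
    rw [h1, h2]
    module
  simp only [hT, zero_smul, Finset.sum_const_zero] at h3
  exact (smul_eq_zero.1 h3).resolve_left (by norm_num)

end WedgeOperators

/-! ### Coordinate expansions, and the Leibniz rule for a closed 2-form -/

section Basis

variable {V : Type*} [NormedAddCommGroup V] [NormedSpace ℝ V] [FiniteDimensional ℝ V] {k : ℕ}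

variable (V) in
/-- The coordinates in a basis of `V`, as complex covectors. -/
def coordCovector (a : Fin (Module.finrank ℝ V)) : V →L[ℝ] ℂ :=
  Complex.ofRealCLM ∘L ((Module.finBasis ℝ V).coord a).toContinuousLinearMap

theorem sum_coord_smul {X : Type*} [NormedAddCommGroup X] [NormedSpace ℝ X] [NormedSpace ℂ X]
    [IsScalarTower ℝ ℂ X] (f : V →L[ℝ] X) (v : V) :
    f v = ∑ a, coordCovector V a v • f (Module.finBasis ℝ V a) := by
  conv_lhs => rw [← (Module.finBasis ℝ V).sum_repr v]
  rw [map_sum]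
  refine Finset.sum_congr rfl fun a _ => ?_
  rw [map_smul]
  change _ = (((Module.finBasis ℝ V).repr v a : ℝ) : ℂ) • _
  exact (algebraMap_smul ℂ _ _).symm

theorem alternatizeUncurryFin_eq_sum (f : V →L[ℝ] V [⋀^Fin k]→L[ℝ] ℂ) :
    alternatizeUncurryFin f =
      ∑ a, wedge1 V k (coordCovector V a) (f (Module.finBasis ℝ V a)) := by
  have h : f = ∑ a, (ContinuousLinearMap.lsmul ℝ ℂ).flip (f (Module.finBasis ℝ V a)) ∘L
      coordCovector V a := by
    ext1 v
    rw [sum_coord_smul f v, _root_.sum_apply]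
    rfl
  conv_lhs => rw [← alternatizeUncurryFinCLM_apply, h, map_sum]
  rfl

theorem wedge1_eq_sum (l : V →L[ℝ] ℂ) (β : V [⋀^Fin k]→L[ℝ] ℂ) :
    wedge1 V k l β =
      ∑ a, l (Module.finBasis ℝ V a) • wedge1 V k (coordCovector V a) β := by
  rw [wedge1, alternatizeBilin_apply, alternatizeUncurryFin_eq_sum]
  exact Finset.sum_congr rfl fun a _ => wedge1_smul _ _ _

theorem wedge2_eq_sum (b : V →L[ℝ] V →L[ℝ] ℂ) (β : V [⋀^Fin k]→L[ℝ] ℂ) :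
    wedge2 V k b β = ∑ a, wedge1 V _ (coordCovector V a)
      (wedge1 V k (b (Module.finBasis ℝ V a)) β) := by
  rw [wedge2, alternatizeBilin_apply, alternatizeUncurryFin_eq_sum]
  rfl

theorem wedge2_eq_sum_sum (b : V →L[ℝ] V →L[ℝ] ℂ) (β : V [⋀^Fin k]→L[ℝ] ℂ) :
    wedge2 V k b β = ∑ a, ∑ a', b (Module.finBasis ℝ V a) (Module.finBasis ℝ V a') •
      wedge1 V _ (coordCovector V a) (wedge1 V k (coordCovector V a') β) := by
  rw [wedge2_eq_sum]
  refine Finset.sum_congr rfl fun a _ => ?_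
  rw [wedge1_eq_sum (b _), map_sum]
  exact Finset.sum_congr rfl fun a' _ => wedge1_smul _ _ _

theorem wedge1_wedge2 (l : V →L[ℝ] ℂ) (b : V →L[ℝ] V →L[ℝ] ℂ) (β : V [⋀^Fin k]→L[ℝ] ℂ) :
    wedge1 V _ l (wedge2 V k b β) = wedge2 V _ b (wedge1 V k l β) := by
  rw [wedge2_eq_sum, wedge2_eq_sum, map_sum]
  refine Finset.sum_congr rfl fun a _ => ?_
  rw [wedge1_wedge1 l, wedge1_wedge1 l, map_neg, neg_neg]

omit [FiniteDimensional ℝ V] in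
theorem fderiv_wedge2 {s : V → V [⋀^Fin 2]→L[ℝ] ℂ} {β : V → V [⋀^Fin k]→L[ℝ] ℂ} {y : V}
    (hs : DifferentiableAt ℝ s y) (hβ : DifferentiableAt ℝ β y) (v : V) :
    fderiv ℝ (fun z => wedge2 V k (curry2 (s z)) (β z)) y v =
      wedge2 V k (curry2 (s y)) (fderiv ℝ β y v) +
        wedge2 V k (curry2 (fderiv ℝ s y v)) (β y) := by
  have h1 : HasFDerivAt (fun z => wedge2 V k (curry2 (s z)))
      (wedge2 V k ∘L curry2 ∘L fderiv ℝ s y) y :=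
    (wedge2 V k).hasFDerivAt.comp y (curry2.hasFDerivAt.comp y hs.hasFDerivAt)
  rw [(h1.clm_apply hβ.hasFDerivAt).fderiv]
  rfl

/-- The wedge product with a closed `2`-form commutes with the exterior derivative. -/
theorem extDeriv_wedge2 {s : V → V [⋀^Fin 2]→L[ℝ] ℂ} {β : V → V [⋀^Fin k]→L[ℝ] ℂ} {y : V}
    (hs : DifferentiableAt ℝ s y) (hβ : DifferentiableAt ℝ β y) (hd : extDeriv s y = 0) :
    extDeriv (fun z => wedge2 V k (curry2 (s z)) (β z)) y =
      wedge2 V (k + 1) (curry2 (s y)) (extDeriv β y) := by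
  -- The terms in which the derivative falls on `s` add up to `∑ ∂_a s_bc dx^a ∧ dx^b ∧ dx^c ∧ β`.
  -- The triple product of covectors is cyclically invariant and the coefficients have zero cyclic
  -- sum.
  have hzero : ∑ c, wedge1 V _ (coordCovector V c)
      (wedge2 V k (curry2 (fderiv ℝ s y (Module.finBasis ℝ V c))) (β y)) = 0 := by
    refine Eq.trans ?_ (sum_cyclic_eq_zero (fun a b c => fderiv ℝ s y (Module.finBasis ℝ V a)
        ![Module.finBasis ℝ V b, Module.finBasis ℝ V c])
      (fun a b c => wedge1 V _ (coordCovector V a) (wedge1 V _ (coordCovector V b)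
        (wedge1 V _ (coordCovector V c) (β y)))) (fun a b c => fderiv_cyclic hd _ _ _) ?_)
    · refine Finset.sum_congr rfl fun a _ => ?_
      rw [wedge2_eq_sum_sum, map_sum]
      refine Finset.sum_congr rfl fun b _ => ?_
      rw [map_sum]
      refine Finset.sum_congr rfl fun c _ => ?_
      rw [wedge1_smul, curry2_apply]
    · intro a b c
      rw [wedge1_wedge1 (coordCovector V c), map_neg,
        wedge1_wedge1 (coordCovector V b) (coordCovector V a), neg_neg]
  rw [extDeriv, extDeriv, alternatizeUncurryFin_eq_sum, alternatizeUncurryFin_eq_sum, map_sum]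
  simp only [fderiv_wedge2 hs hβ, map_add]
  rw [Finset.sum_add_distrib, hzero, add_zero]
  exact Finset.sum_congr rfl fun a _ => wedge1_wedge2 _ _ _

end Basis

open ContinuousAlternatingMap (constOfIsEmpty curryLeft_apply_apply)

/-! ### Operators on forms of all degrees at once -/

section TotalForms

variable {V : Type*} [NormedAddCommGroup V] [NormedSpace ℝ V] {k : ℕ}

variable (V) in
/-- Families of complex forms on `V`, one in each degree. -/
abbrev TotalForm : Type _ := ∀ k : ℕ, V [⋀^Fin k]→L[ℝ] ℂ

/-- The wedge product with a covector, in all degrees. -/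
def exteriorMul (l : V →L[ℝ] ℂ) : Module.End ℂ (TotalForm V) where
  toFun t
    | 0 => 0
    | k + 1 => wedge1 V k l (t k)
  map_add' s t := by
    funext k
    match k with
    | 0 => exact (add_zero _).symm
    | k + 1 => exact map_add _ _ _
  map_smul' c t := by
    funext k
    match k with
    | 0 => exact (smul_zero c).symm
    | k + 1 => exact wedge1_smul _ _ _

/-- Twice the wedge product with the `2`-form of a bilinear form, in all degrees. -/
def lefschetz (b : V →L[ℝ] V →L[ℝ] ℂ) : Module.End ℂ (TotalForm V) where
  toFun t
    | 0 => 0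
    | 1 => 0
    | k + 2 => wedge2 V k b (t k)
  map_add' s t := by
    funext k
    match k with
    | 0 => exact (add_zero _).symm
    | 1 => exact (add_zero _).symm
    | k + 2 => exact map_add _ _ _
  map_smul' c t := by
    funext k
    match k with
    | 0 => exact (smul_zero c).symm
    | 1 => exact (smul_zero c).symm
    | k + 2 => exact wedge2_smul _ _ _

/-- The contraction with a vector, in all degrees. -/
def contraction (v : V) : Module.End ℂ (TotalForm V) where
  toFun t k := (t (k + 1)).curryLeft v
  map_add' s t := by funext k; ext w; rfl
  map_smul' c t := by funext k; ext w; rfl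

variable (V) in
/-- The constant function `1`, as a form. -/
def unitForm : TotalForm V
  | 0 => constOfIsEmpty ℝ V (Fin 0) 1
  | _ + 1 => 0

/-- The complex conjugate, in all degrees. -/
def conjTotal (t : TotalForm V) : TotalForm V := fun k => conjForm (t k)

theorem conjTotal_add (s t : TotalForm V) : conjTotal (s + t) = conjTotal s + conjTotal t := by
  funext k; ext v
  exact map_add (starRingEnd ℂ) _ _

theorem conjTotal_smul (c : ℂ) (t : TotalForm V) :
    conjTotal (c • t) = (starRingEnd ℂ c) • conjTotal t := by
  funext k; ext v
  exact map_mul (starRingEnd ℂ) _ _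

theorem conjTotal_unitForm : conjTotal (unitForm V) = unitForm V := by
  funext k; ext v
  match k with
  | 0 => exact map_one (starRingEnd ℂ)
  | k + 1 => exact map_zero (starRingEnd ℂ)

theorem conjTotal_lefschetz (s : V [⋀^Fin 2]→L[ℝ] ℂ) (t : TotalForm V) :
    conjTotal (lefschetz (curry2 s) t) = lefschetz (curry2 (conjForm s)) (conjTotal t) := by
  funext k
  match k with
  | 0 => ext v; exact map_zero (starRingEnd ℂ)
  | 1 => ext v; exact map_zero (starRingEnd ℂ)
  | k + 2 =>
    refine (conjForm_wedge2 _ _).trans ?_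
    rw [← curry2_conjForm]
    rfl

theorem conjTotal_lefschetz_pow (s : V [⋀^Fin 2]→L[ℝ] ℂ) (r : ℕ) (t : TotalForm V) :
    conjTotal ((lefschetz (curry2 s) ^ r) t) =
      (lefschetz (curry2 (conjForm s)) ^ r) (conjTotal t) := by
  induction r with
  | zero => rfl
  | succ r ih =>
    rw [pow_succ', pow_succ', Module.End.mul_apply, Module.End.mul_apply, conjTotal_lefschetz, ih]

theorem lefschetz_add (b b' : V →L[ℝ] V →L[ℝ] ℂ) :
    lefschetz (b + b') = lefschetz b + lefschetz b' := by
  ext1 t; funext k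
  match k with
  | 0 => exact (add_zero _).symm
  | 1 => exact (add_zero _).symm
  | k + 2 => exact congrArg (fun f => f (t k)) ((wedge2 V k).map_add b b')

/-- A total form may have uncontrolled components in other degrees; this allows hypotheses known in
a single degree to be multiplied. -/
theorem lefschetz_pow_congr (b : V →L[ℝ] V →L[ℝ] ℂ) {s t : TotalForm V} {r k : ℕ}
    (h : s k = t k) : (lefschetz b ^ r) s (k + 2 * r) = (lefschetz b ^ r) t (k + 2 * r) := by
  induction r with
  | zero => exact h
  | succ r ih =>
    rw [pow_succ', Module.End.mul_apply, Module.End.mul_apply]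
    exact congrArg (wedge2 V (k + 2 * r) b) ih

theorem lefschetz_pow_unitForm_of_ne (b : V →L[ℝ] V →L[ℝ] ℂ) {r k : ℕ} (h : k ≠ 2 * r) :
    (lefschetz b ^ r) (unitForm V) k = 0 := by
  induction r generalizing k with
  | zero =>
    match k with
    | 0 => exact absurd rfl h
    | k + 1 => rfl
  | succ r ih =>
    rw [pow_succ', Module.End.mul_apply]
    match k with
    | 0 => rfl
    | 1 => rfl
    | k + 2 =>
      change wedge2 V k b _ = 0
      rw [ih (by omega), map_zero]

theorem contraction_unitForm (v : V) : contraction v (unitForm V) = 0 := by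
  funext k; ext w; rfl

/-- The Clifford relation. It comes from splitting off the term of the alternating sum in which `l`
receives `v`. -/
theorem contraction_exteriorMul (v : V) (l : V →L[ℝ] ℂ) :
    contraction v * exteriorMul l = l v • 1 - exteriorMul l * contraction v := by
  ext1 t; funext k; ext w
  match k with
  | 0 =>
    change wedge1 V 0 l (t 0) (Matrix.vecCons v w) = l v * t 0 w - 0
    rw [wedge1_apply, Fin.sum_univ_succ, Finset.univ_eq_empty, Finset.sum_empty, add_zero,
      sub_zero]
    simp only [Fin.val_zero, pow_zero, one_smul]
    rfl
  | k + 1 =>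
    change wedge1 V (k + 1) l (t (k + 1)) (Matrix.vecCons v w) =
      l v * t (k + 1) w - wedge1 V k l ((t (k + 1)).curryLeft v) w
    rw [wedge1_apply, wedge1_apply, Fin.sum_univ_succ, sub_eq_add_neg, ← Finset.sum_neg_distrib]
    congr 1
    · simp only [Fin.val_zero, pow_zero, one_smul]
      rfl
    · refine Finset.sum_congr rfl fun i _ => ?_
      rw [Fin.val_succ, pow_succ, mul_neg_one, neg_smul, curryLeft_apply_apply]
      congr 5
      funext j
      refine Fin.cases ?_ (fun j => ?_) j <;> simp [Fin.removeNth]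

variable (V) in
/-- A nonzero form whose degree is not maximal has a nonzero product with some real covector. -/
theorem exists_exteriorMul_ne_zero [FiniteDimensional ℝ V] {t : TotalForm V} {k : ℕ}
    (ht : t k ≠ 0) (hk : k < Module.finrank ℝ V) :
    ∃ l : V →L[ℝ] ℝ, exteriorMul (Complex.ofRealCLM ∘L l) t ≠ 0 := by
  obtain ⟨v, hv⟩ : ∃ v, t k v ≠ 0 := by
    by_contra! h
    exact ht (by ext v; exact h v)
  -- The `k` arguments `v` do not span, so some functional `f` kills all of them but not some `u`.
  -- Then `(f ∧ t)(u, v) = f(u) t(v)`.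
  have hlt : Submodule.span ℝ (Set.range v) < ⊤ := by
    rw [lt_top_iff_ne_top]
    intro h
    have h1 := finrank_range_le_card (R := ℝ) v
    rw [Set.finrank, h, finrank_top, Fintype.card_fin] at h1
    omega
  obtain ⟨f, hf, hle⟩ := Submodule.exists_le_ker_of_lt_top _ hlt
  obtain ⟨u, hu⟩ : ∃ u, f u ≠ 0 := by
    by_contra! h
    exact hf (LinearMap.ext h)
  refine ⟨f.toContinuousLinearMap, fun h => ?_⟩
  have h1 := congrArg (fun s : TotalForm V => s (k + 1) (Matrix.vecCons u v)) h
  change wedge1 V k _ (t k) (Matrix.vecCons u v) = 0 at h1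
  rw [wedge1_apply, Fin.sum_univ_succ, Finset.sum_eq_zero, add_zero] at h1
  · simp only [Fin.val_zero, pow_zero, one_smul] at h1
    refine mul_ne_zero ?_ hv h1
    exact Complex.ofReal_ne_zero.2 hu
  · intro i _
    have h2 : f (v i) = 0 := hle (Submodule.subset_span ⟨i, rfl⟩)
    have h3 : (Complex.ofRealCLM ∘L f.toContinuousLinearMap) (Matrix.vecCons u v i.succ) = 0 := by
      change ((f (v i) : ℝ) : ℂ) = 0
      rw [h2, Complex.ofReal_zero]
    rw [h3, zero_mul, smul_zero]

/-- A form that is complex linear with respect to a complex structure vanishes in degrees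
greater than the complex dimension. -/
theorem eq_zero_of_contraction_eq [FiniteDimensional ℝ V] {J : V →L[ℝ] V}
    {t : TotalForm V} (ht : ∀ v, contraction (J v) t = Complex.I • contraction v t) {k : ℕ}
    (hk : Module.finrank ℝ V < 2 * k) : t k = 0 := by
  obtain ⟨k, rfl⟩ : ∃ j, k = j + 1 := ⟨k - 1, by omega⟩
  ext v
  change t (k + 1) v = 0
  -- More vectors than the real dimension: a real relation among the `v i` and `J (v i)` is a
  -- complex relation among the `v i`.
  let w : Fin (k + 1) ⊕ Fin (k + 1) → V := Sum.elim v (fun i => J (v i))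
  have hdep : ¬ LinearIndependent ℝ w := fun h => by
    have := h.fintype_card_le_finrank
    simp only [Fintype.card_sum, Fintype.card_fin] at this
    omega
  obtain ⟨g, hg, i₀, hi₀⟩ := Fintype.not_linearIndependent_iff.1 hdep
  rw [Fintype.sum_sum_type] at hg
  have hz : ∃ j, (g (Sum.inl j) : ℂ) + g (Sum.inr j) * Complex.I ≠ 0 := by
    rcases i₀ with j | j <;> refine ⟨j, fun h => hi₀ ?_⟩
    · simpa using congrArg Complex.re h
    · simpa using congrArg Complex.im h
  obtain ⟨j, hj⟩ := hz
  have hterm (x : V) (a b : ℝ) : t (k + 1) (Matrix.vecCons (a • x + b • J x) (j.removeNth v)) =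
      ((a : ℂ) + b * Complex.I) * t (k + 1) (Matrix.vecCons x (j.removeNth v)) := by
    have h1 := congrArg (fun s : TotalForm V => s k (j.removeNth v)) (ht x)
    change t (k + 1) (Matrix.vecCons (J x) (j.removeNth v)) =
      Complex.I * t (k + 1) (Matrix.vecCons x (j.removeNth v)) at h1
    rw [← curryLeft_apply_apply, map_add, map_smul, map_smul]
    change a • t (k + 1) (Matrix.vecCons x (j.removeNth v)) +
      b • t (k + 1) (Matrix.vecCons (J x) (j.removeNth v)) = _
    rw [h1, Complex.real_smul, Complex.real_smul]
    ring
  have hsum : ∑ i, (g (Sum.inl i) • v i + g (Sum.inr i) • J (v i)) = 0 := by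
    rw [Finset.sum_add_distrib]
    exact hg
  have h0 : ∑ i, ((g (Sum.inl i) : ℂ) + g (Sum.inr i) * Complex.I) *
      t (k + 1) (Matrix.vecCons (v i) (j.removeNth v)) = 0 := by
    have : (t (k + 1)).curryLeft (∑ i, (g (Sum.inl i) • v i + g (Sum.inr i) • J (v i)))
        (j.removeNth v) = 0 := by
      rw [hsum, map_zero]; rfl
    rw [map_sum, ContinuousAlternatingMap.sum_apply] at this
    exact (Finset.sum_congr rfl fun i _ => (hterm _ _ _).symm).trans this
  -- The relation is inserted in the slot of `v j`: the terms `i ≠ j` repeat an argument, and the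
  -- remaining one has a nonzero coefficient.
  rw [Finset.sum_eq_single j] at h0
  · have h2 := (mul_eq_zero.1 h0).resolve_left hj
    rw [← (t (k + 1)).neg_one_pow_smul_map_insertNth j, Fin.insertNth_removeNth,
      Function.update_eq_self] at h2
    rcases neg_one_pow_eq_or ℤ (j : ℕ) with h | h <;> simpa [h] using h2
  · intro i _ hij
    obtain ⟨i', rfl⟩ := Fin.exists_succAbove_eq hij
    rw [(t (k + 1)).map_eq_zero_of_eq (i := 0) (j := i'.succ) _ rfl (Fin.succ_ne_zero _).symm,
      mul_zero]
  · intro h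
    exact absurd (Finset.mem_univ j) h

end TotalForms

/-! ### Linear algebra of a complex symplectic form -/

section PointwiseSymplectic

variable {V : Type*} [NormedAddCommGroup V] [NormedSpace ℝ V]

theorem exteriorMul_add (l l' : V →L[ℝ] ℂ) :
    exteriorMul (l + l') = exteriorMul l + exteriorMul l' := by
  ext1 t; funext k
  match k with
  | 0 => exact (add_zero _).symm
  | k + 1 => exact congrArg (fun f => f (t k)) ((wedge1 V k).map_add l l')

theorem exteriorMul_smul (c : ℂ) (l : V →L[ℝ] ℂ) : exteriorMul (c • l) = c • exteriorMul l := by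
  ext1 t; funext k
  match k with
  | 0 => exact (smul_zero c).symm
  | k + 1 => exact wedge1_smul_left c l (t k)

variable (V) in
/-- `exteriorMul` as a linear map. -/
def exteriorMulₗ : (V →L[ℝ] ℂ) →ₗ[ℂ] Module.End ℂ (TotalForm V) where
  toFun := exteriorMul
  map_add' := exteriorMul_add
  map_smul' := exteriorMul_smul

variable [FiniteDimensional ℝ V]

theorem lefschetz_eq_sum (b : V →L[ℝ] V →L[ℝ] ℂ) :
    lefschetz b = ∑ a, exteriorMul (coordCovector V a) *
      exteriorMul (b (Module.finBasis ℝ V a)) := by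
  ext1 t; funext k
  rw [LinearMap.sum_apply, Finset.sum_apply]
  match k with
  | 0 => exact (Finset.sum_eq_zero fun _ _ => rfl).symm
  | 1 => exact (Finset.sum_eq_zero fun _ _ => (wedge1 V 0 _).map_zero).symm
  | k + 2 => exact wedge2_eq_sum _ _

theorem exteriorMul_commute_lefschetz (l : V →L[ℝ] ℂ) (b : V →L[ℝ] V →L[ℝ] ℂ) :
    Commute (exteriorMul l) (lefschetz b) := by
  ext1 t; funext k
  match k with
  | 0 => rfl
  | 1 => exact (wedge1 V 0 _).map_zero
  | 2 => exact (map_zero (wedge1 V 1 _)).trans (map_zero (wedge2 V 0 _)).symm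
  | k + 3 => exact wedge1_wedge2 _ _ _

theorem lefschetz_commute (b b' : V →L[ℝ] V →L[ℝ] ℂ) : Commute (lefschetz b) (lefschetz b') := by
  rw [lefschetz_eq_sum b]
  exact Commute.sum_left _ _ _ fun a _ =>
    (exteriorMul_commute_lefschetz _ _).mul_left (exteriorMul_commute_lefschetz _ _)

theorem exteriorMul_eq_sum (l : V →L[ℝ] ℂ) :
    exteriorMul l = ∑ a, l (Module.finBasis ℝ V a) • exteriorMul (coordCovector V a) := by
  have h : l = ∑ a, l (Module.finBasis ℝ V a) • coordCovector V a := by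
    ext1 v
    rw [sum_coord_smul l v, _root_.sum_apply]
    exact Finset.sum_congr rfl fun a _ => mul_comm _ _
  conv_lhs => rw [h]
  change exteriorMulₗ V _ = _
  rw [map_sum]
  exact Finset.sum_congr rfl fun a _ => map_smul (exteriorMulₗ V) _ _

/-- Contraction past a product of two covectors has no net sign. Each of the two factors in `∑ dx^a
∧ b(e_a)` contributes one `b v`, the second by antisymmetry; hence the factor `2`. -/
theorem contraction_mul_lefschetz {b : V →L[ℝ] V →L[ℝ] ℂ} (hb : ∀ u v, b u v = - b v u) (v : V) :
    contraction v * lefschetz b = lefschetz b * contraction v + (2 : ℂ) • exteriorMul (b v) := by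
  have h1 : ∑ a, coordCovector V a v • exteriorMul (b (Module.finBasis ℝ V a)) =
      exteriorMul (b v) := by
    have h := sum_coord_smul b v
    rw [h]
    change _ = exteriorMulₗ V _
    rw [map_sum]
    exact Finset.sum_congr rfl fun a _ => (map_smul (exteriorMulₗ V) _ _).symm
  have h2 : ∑ a, b (Module.finBasis ℝ V a) v • exteriorMul (coordCovector V a) =
      - exteriorMul (b v) := by
    rw [exteriorMul_eq_sum (b v), ← Finset.sum_neg_distrib]
    exact Finset.sum_congr rfl fun a _ => by rw [hb, neg_smul]
  have h3 (a) : contraction v * (exteriorMul (coordCovector V a) *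
      exteriorMul (b (Module.finBasis ℝ V a))) =
      coordCovector V a v • exteriorMul (b (Module.finBasis ℝ V a)) -
        b (Module.finBasis ℝ V a) v • exteriorMul (coordCovector V a) +
        exteriorMul (coordCovector V a) * exteriorMul (b (Module.finBasis ℝ V a)) *
          contraction v := by
    rw [← mul_assoc, contraction_exteriorMul, sub_mul, mul_assoc, contraction_exteriorMul,
      mul_sub, smul_one_mul, mul_smul_one, mul_assoc]
    abel
  rw [lefschetz_eq_sum, Finset.mul_sum, Finset.sum_congr rfl fun a _ => h3 a,
    Finset.sum_add_distrib, Finset.sum_sub_distrib, h1, h2, Finset.sum_mul, two_smul]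
  abel

theorem contraction_lefschetz_pow {b : V →L[ℝ] V →L[ℝ] ℂ} (hb : ∀ u v, b u v = - b v u) (v : V)
    (r : ℕ) : contraction v ((lefschetz b ^ (r + 1)) (unitForm V)) =
      (2 * (r + 1) : ℂ) • exteriorMul (b v) ((lefschetz b ^ r) (unitForm V)) := by
  induction r with
  | zero =>
    rw [zero_add, pow_one, pow_zero, ← Module.End.mul_apply, contraction_mul_lefschetz hb,
      LinearMap.add_apply, Module.End.mul_apply, contraction_unitForm, map_zero, zero_add]
    simp
  | succ r ih =>
    have hc := congrArg (fun f => f ((lefschetz b ^ r) (unitForm V)))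
      (exteriorMul_commute_lefschetz (b v) b).eq
    simp only [Module.End.mul_apply] at hc
    have hp : lefschetz b ((lefschetz b ^ r) (unitForm V)) =
        (lefschetz b ^ (r + 1)) (unitForm V) := by
      rw [pow_succ', Module.End.mul_apply]
    rw [pow_succ', Module.End.mul_apply, ← Module.End.mul_apply, contraction_mul_lefschetz hb,
      LinearMap.add_apply, Module.End.mul_apply, ih, map_smul, ← hc, hp, LinearMap.smul_apply,
      ← add_smul]
    congr 1
    push_cast; ring

/-- By `contraction_lefschetz_pow`, a power of `b` is again complex linear in its arguments, while
its degree `2 * r` exceeds half the real dimension. -/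
theorem lefschetz_pow_eq_zero {J : V →L[ℝ] V} {b : V →L[ℝ] V →L[ℝ] ℂ}
    (hb : ∀ u v, b u v = - b v u) (hJ : ∀ v, b (J v) = Complex.I • b v) {r : ℕ}
    (hr : Module.finrank ℝ V < 4 * r) : (lefschetz b ^ r) (unitForm V) = 0 := by
  funext k
  by_cases hk : k = 2 * r
  · obtain ⟨r, rfl⟩ : ∃ j, r = j + 1 := ⟨r - 1, by omega⟩
    refine eq_zero_of_contraction_eq (J := J) (fun v => ?_) (by omega)
    rw [contraction_lefschetz_pow hb, contraction_lefschetz_pow hb, hJ, exteriorMul_smul,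
      LinearMap.smul_apply, smul_comm]
  · exact lefschetz_pow_unitForm_of_ne b hk

/-- If the power `r + 1` vanished, contracting it with `v` would give `b v ∧ b^r = 0` for all `v`.
By `hsurj` every real covector would then kill `b^r`, which is nonzero of non-maximal degree. -/
theorem lefschetz_pow_ne_zero {b : V →L[ℝ] V →L[ℝ] ℂ} (hb : ∀ u v, b u v = - b v u)
    (hsurj : ∀ l : V →L[ℝ] ℝ, ∃ v, b v = Complex.ofRealCLM ∘L l) {r : ℕ}
    (hr : 2 * r ≤ Module.finrank ℝ V) : (lefschetz b ^ r) (unitForm V) (2 * r) ≠ 0 := by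
  induction r with
  | zero =>
    intro h
    have := congrArg (fun f => f 0) h
    exact one_ne_zero (α := ℂ) this
  | succ r ih =>
    intro h
    have h0 : (lefschetz b ^ (r + 1)) (unitForm V) = 0 := by
      funext k
      by_cases hk : k = 2 * (r + 1)
      · subst hk; exact h
      · exact lefschetz_pow_unitForm_of_ne b hk
    obtain ⟨l, hl⟩ := exists_exteriorMul_ne_zero V (ih (by omega)) (by omega)
    obtain ⟨v, hv⟩ := hsurj l
    refine hl ?_
    have h1 := contraction_lefschetz_pow hb v r
    rw [h0, map_zero, hv] at h1
    refine (smul_eq_zero.1 h1.symm).resolve_left ?_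
    exact_mod_cast (by omega : 2 * (r + 1) ≠ 0)

/-- The pointwise properties of a complex symplectic form. -/
structure IsSymplecticCovector (J : V →L[ℝ] V) (s : V [⋀^Fin 2]→L[ℝ] ℂ) : Prop where
  map_left : ∀ u v, s ![J u, v] = Complex.I * s ![u, v]
  nondegenerate : ∀ v, (∀ w, s ![v, w] = 0) → v = 0

namespace IsSymplecticCovector

variable {J : V →L[ℝ] V} {s : V [⋀^Fin 2]→L[ℝ] ℂ}

theorem lefschetz_pow_eq_zero (h : IsSymplecticCovector J s) {r : ℕ}
    (hr : Module.finrank ℝ V < 4 * r) : (lefschetz (curry2 s) ^ r) (unitForm V) = 0 := by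
  refine SmoothForms.lefschetz_pow_eq_zero (J := J) (curry2_swap s) (fun v => ?_) hr
  ext w
  rw [curry2_apply, h.map_left, ← curry2_apply]
  rfl

theorem lefschetz_conj_pow_eq_zero (h : IsSymplecticCovector J s) {r : ℕ}
    (hr : Module.finrank ℝ V < 4 * r) :
    (lefschetz (curry2 (conjForm s)) ^ r) (unitForm V) = 0 := by
  rw [← conjTotal_unitForm, ← conjTotal_lefschetz_pow, h.lefschetz_pow_eq_zero hr]
  funext k; ext v
  exact map_zero (starRingEnd ℂ)

/-- The real `2`-form `s + conj s = 2 Re s` is non-degenerate, in the form required by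
`lefschetz_pow_ne_zero`. -/
theorem exists_curry2_eq (h : IsSymplecticCovector J s) (l : V →L[ℝ] ℝ) :
    ∃ v, curry2 (s + conjForm s) v = Complex.ofRealCLM ∘L l := by
  let T : V →ₗ[ℝ] (V →L[ℝ] ℝ) :=
    (ContinuousLinearMap.compL ℝ V ℂ ℝ Complex.reCLM ∘L curry2 s).toLinearMap
  have hT (v w : V) : T v w = (s ![v, w]).re := by
    rw [← curry2_apply]; rfl
  have hinj : Function.Injective T := by
    refine (injective_iff_map_eq_zero T).2 fun v hv => h.nondegenerate v fun w => ?_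
    have h1 (w : V) : (s ![v, w]).re = 0 := by rw [← hT, hv]; rfl
    refine Complex.ext (h1 w) ?_
    -- `s(v, J w) = i s(v, w)`, so the real part at `J w` is minus the imaginary part at `w`.
    have h2 := h1 (J w)
    rw [← curry2_apply, curry2_swap, curry2_apply, h.map_left, ← curry2_apply, curry2_swap,
      curry2_apply] at h2
    simpa using h2
  have hdim : Module.finrank ℝ V = Module.finrank ℝ (V →L[ℝ] ℝ) := by
    rw [← Subspace.dual_finrank_eq (K := ℝ) (V := V)]
    exact (LinearMap.toContinuousLinearMap (𝕜 := ℝ) (E := V) (F' := ℝ)).finrank_eq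
  obtain ⟨v, hv⟩ := (LinearMap.injective_iff_surjective_of_finrank_eq_finrank hdim).1 hinj
    -- The factor `1 / 2` compensates for `s + conj s = 2 Re s`.
    ((1 / 2 : ℝ) • l)
  refine ⟨v, ?_⟩
  ext w
  have h1 : (s ![v, w]).re = 1 / 2 * l w := by rw [← hT, hv]; rfl
  rw [curry2_apply]
  change s ![v, w] + starRingEnd ℂ (s ![v, w]) = ((l w : ℝ) : ℂ)
  rw [Complex.add_conj, h1]
  congr 1; ring

omit [FiniteDimensional ℝ V] in
theorem conjForm_add_conjForm (s : V [⋀^Fin 2]→L[ℝ] ℂ) :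
    conjForm (s + conjForm s) = s + conjForm s := by
  ext v
  change starRingEnd ℂ (s v + starRingEnd ℂ (s v)) = s v + starRingEnd ℂ (s v)
  rw [map_add, Complex.conj_conj, add_comm]

/-- The product of powers of a complex symplectic form and its conjugate. -/
def powers (s : V [⋀^Fin 2]→L[ℝ] ℂ) (i j : ℕ) : TotalForm V :=
  (lefschetz (curry2 s) ^ i) ((lefschetz (curry2 (conjForm s)) ^ j) (unitForm V))

theorem powers_eq_zero_left (h : IsSymplecticCovector J s) {i : ℕ} (j : ℕ)
    (hi : Module.finrank ℝ V < 4 * i) : powers s i j = 0 := by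
  rw [powers, ← Module.End.mul_apply, ((lefschetz_commute _ _).pow_pow i j).eq,
    Module.End.mul_apply, h.lefschetz_pow_eq_zero hi, map_zero]

theorem powers_eq_zero_right (h : IsSymplecticCovector J s) (i : ℕ) {j : ℕ}
    (hj : Module.finrank ℝ V < 4 * j) : powers s i j = 0 := by
  rw [powers, h.lefschetz_conj_pow_eq_zero hj, map_zero]

theorem lefschetz_pow_powers (s : V [⋀^Fin 2]→L[ℝ] ℂ) (a b i j : ℕ) :
    (lefschetz (curry2 s) ^ a) ((lefschetz (curry2 (conjForm s)) ^ b) (powers s i j)) =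
      powers s (a + i) (b + j) := by
  simp only [powers, ← Module.End.mul_apply]
  have hc := ((lefschetz_commute (curry2 s) (curry2 (conjForm s))).pow_pow i b).eq
  rw [pow_add, pow_add, mul_assoc, ← mul_assoc (_ ^ i) (_ ^ b), hc, mul_assoc (_ ^ b)]

theorem conjTotal_powers (s : V [⋀^Fin 2]→L[ℝ] ℂ) (i j : ℕ) :
    conjTotal (powers s i j) = powers s j i := by
  have hss : conjForm (conjForm s) = s := by
    ext v; exact Complex.conj_conj _
  rw [powers, powers, conjTotal_lefschetz_pow, conjTotal_lefschetz_pow, hss, conjTotal_unitForm,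
    ← Module.End.mul_apply, ← Module.End.mul_apply, ((lefschetz_commute _ _).pow_pow i j).eq]

/-- The volume form of a complex symplectic form: a real form, and a multiple of the product of
the top powers of the symplectic form and of its conjugate. -/
theorem lefschetz_pow_eq_smul_powers (h : IsSymplecticCovector J s) {n : ℕ}
    (hn : Module.finrank ℝ V = 4 * n) :
    (lefschetz (curry2 (s + conjForm s)) ^ (2 * n)) (unitForm V) =
      ((2 * n).choose n : ℂ) • powers s n n := by
  rw [map_add, lefschetz_add, (lefschetz_commute _ _).add_pow, LinearMap.sum_apply,
    Finset.sum_eq_single n]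
  · rw [show 2 * n - n = n by omega, ← nsmul_eq_mul', LinearMap.smul_apply, Module.End.mul_apply,
      ← Nat.cast_smul_eq_nsmul ℂ]
    rfl
  · intro i _ hi
    rw [← nsmul_eq_mul', LinearMap.smul_apply, Module.End.mul_apply]
    refine (congrArg (_ • ·) ?_).trans (smul_zero _)
    -- The exponents add up to `2 * n`, so if they are not both `n`, one of them exceeds `n`.
    rcases lt_or_gt_of_ne hi with hi | hi
    · exact h.powers_eq_zero_right _ (by omega)
    · exact h.powers_eq_zero_left _ (by omega)
  · intro hn'
    exact absurd (Finset.mem_range.2 (by omega)) hn'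

end IsSymplecticCovector

omit [FiniteDimensional ℝ V] in
theorem map_left_of_mem_bidegree {J : V →L[ℝ] V} {s : V [⋀^Fin 2]→L[ℝ] ℂ}
    (hs : s ∈ bidegree J 2 0) (u v : V) : s ![J u, v] = Complex.I * s ![u, v] := by
  induction hs using Submodule.span_induction with
  | mem α hα =>
    obtain ⟨l, hl, -, h⟩ := hα
    have h0 := hl 0 (by decide) u
    have h1 := hl 1 (by decide) u
    rw [h, h]
    change Matrix.det (n := Fin 2) _ = _ * Matrix.det (n := Fin 2) _
    rw [Matrix.det_fin_two, Matrix.det_fin_two]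
    change l 0 (J u) * l 1 v - l 0 v * l 1 (J u) = Complex.I * (l 0 u * l 1 v - l 0 v * l 1 u)
    rw [h0, h1]; ring
  | zero => exact (mul_zero _).symm
  | add α β _ _ hα hβ =>
    change α _ + β _ = Complex.I * (α _ + β _)
    rw [hα, hβ, mul_add]
  | smul c α _ hα =>
    change c * α _ = Complex.I * (c * α _)
    rw [hα]; ring

end PointwiseSymplectic

/-! ### Differential forms on the manifold: wedge products and exterior derivative -/

section Fields

variable {E : Type*} [NormedAddCommGroup E] [NormedSpace ℝ E]
  {M : Type*} [TopologicalSpace M] [ChartedSpace E M]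
  {F : Type*} [NormedAddCommGroup F] [NormedSpace ℝ F]
  {F' : Type*} [NormedAddCommGroup F'] [NormedSpace ℝ F'] {k : ℕ}

/-- A form is recovered from its expression in a chart. -/
theorem inChart_compContinuousLinearMap [IsManifold 𝓘(ℝ, E) ∞ M] (α : FormField E M F k) (x : M) :
    (inChart α x (chartAt E x x)).compContinuousLinearMap
      (mfderiv 𝓘(ℝ, E) 𝓘(ℝ, E) (chartAt E x) x) = α x := by
  have : IsManifold 𝓘(ℝ, E) 1 M := .of_le (n := ∞) (by simp)
  have hx := mem_chart_source E x
  have hinv := (mdifferentiable_chart (I := 𝓘(ℝ, E)) x).symm_comp_deriv hx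
  have key : ∀ (p q : M) (A : E →L[ℝ] E), p = q →
      (show E [⋀^Fin k]→L[ℝ] F from α p).compContinuousLinearMap A =
      (show E [⋀^Fin k]→L[ℝ] F from α q).compContinuousLinearMap A := by
    rintro p _ A rfl; rfl
  refine (key _ _ ((mfderiv 𝓘(ℝ, E) 𝓘(ℝ, E) (chartAt E x).symm (chartAt E x x)).comp
      (mfderiv 𝓘(ℝ, E) 𝓘(ℝ, E) (chartAt E x) x)) ((chartAt E x).left_inv hx)).trans ?_
  ext v
  refine congrArg (α x) ?_
  funext i
  exact DFunLike.congr_fun hinv (v i)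

/-- Reduces identities between forms on `M` to identities on the model space, at the centre of each
chart. -/
theorem formField_ext [IsManifold 𝓘(ℝ, E) ∞ M] {α β : FormField E M F k}
    (h : ∀ x, inChart α x (chartAt E x x) = inChart β x (chartAt E x x)) : α = β := by
  funext x
  rw [← inChart_compContinuousLinearMap α x, h, inChart_compContinuousLinearMap]

/-- The value of a form at a point, as a form on the model space. -/
def modelForm (α : FormField E M F k) (x : M) : E [⋀^Fin k]→L[ℝ] F := α x

/-- The composition of alternating forms with a linear map on the values. -/
def postcomp (g : F →L[ℝ] F') : (E [⋀^Fin k]→L[ℝ] F) →L[ℝ] (E [⋀^Fin k]→L[ℝ] F') :=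
  ContinuousLinearMap.compContinuousAlternatingMapCLM ℝ E F F' (Fin k) g

/-- The image of a form by a linear map on the values. -/
def mapForm (g : F →L[ℝ] F') (α : FormField E M F k) : FormField E M F' k := fun x =>
  g.compContinuousAlternatingMap (α x)

theorem inChart_mapForm (g : F →L[ℝ] F') (α : FormField E M F k) (x₀ : M) :
    inChart (mapForm g α) x₀ = fun y => g.compContinuousAlternatingMap (inChart α x₀ y) := by
  ext y v; rfl

theorem IsSmoothForm.mapForm (g : F →L[ℝ] F') {α : FormField E M F k} (hα : IsSmoothForm α) :
    IsSmoothForm (mapForm g α) := fun x₀ => by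
  rw [inChart_mapForm]
  exact (postcomp (E := E) (k := k) g).contDiff.comp_contDiffOn (hα x₀)

theorem extD_mapForm [IsManifold 𝓘(ℝ, E) ∞ M] (g : F →L[ℝ] F') {α : FormField E M F k}
    (hα : IsSmoothForm α) : extD (mapForm g α) = mapForm g (extD α) := by
  refine formField_ext fun x => ?_
  have hx := mem_chart_target E x
  rw [inChart_extD (hα.mapForm g) x hx, inChart_mapForm, inChart_mapForm]
  beta_reduce
  rw [inChart_extD hα x hx]
  have h : HasFDerivAt (fun y => g.compContinuousAlternatingMap (inChart α x y))
      (postcomp g ∘L fderiv ℝ (inChart α x) (chartAt E x x))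
      (chartAt E x x) :=
    (postcomp (E := E) (k := k) g).hasFDerivAt.comp _
      (hα.differentiableAt hx).hasFDerivAt
  ext v
  rw [extDeriv, h.fderiv, ContinuousLinearMap.compContinuousAlternatingMap_coe,
    Function.comp_apply, extDeriv, ContinuousAlternatingMap.alternatizeUncurryFin_apply,
    ContinuousAlternatingMap.alternatizeUncurryFin_apply, map_sum]
  exact Finset.sum_congr rfl fun i _ => (map_zsmul g _ _).symm

theorem extD_zero : extD (0 : FormField E M F k) = 0 := by
  funext x
  have h : extDeriv (inChart (0 : FormField E M F k) x) (chartAt E x x) = 0 := by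
    rw [inChart_zero, extDeriv, fderiv_zero]
    exact map_zero (ContinuousAlternatingMap.alternatizeUncurryFinCLM ℝ E F)
  rw [extD, h]
  rfl

/-- Twice the wedge product of a `2`-form and a `k`-form. -/
def wedgeForm (s : FormField E M ℂ 2) (β : FormField E M ℂ k) : FormField E M ℂ (k + 2) :=
  fun x => wedge2 E k (curry2 (modelForm s x)) (modelForm β x)

theorem inChart_wedgeForm (s : FormField E M ℂ 2) (β : FormField E M ℂ k) (x₀ : M) :
    inChart (wedgeForm s β) x₀ =
      fun y => wedge2 E k (curry2 (inChart s x₀ y)) (inChart β x₀ y) := by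
  funext y
  refine (wedge2_compContinuousLinearMap (V := E) (W := E) _ _ _).trans ?_
  exact congrArg (fun b => wedge2 E k b (inChart β x₀ y))
    (curry2_compContinuousLinearMap (V := E) (W := E) _ _).symm

theorem IsSmoothForm.wedgeForm {s : FormField E M ℂ 2} {β : FormField E M ℂ k}
    (hs : IsSmoothForm s) (hβ : IsSmoothForm β) : IsSmoothForm (wedgeForm s β) := fun x₀ => by
  rw [inChart_wedgeForm]
  have h1 : ContDiffOn ℝ ∞ (fun y => curry2 (inChart s x₀ y)) (chartAt E x₀).target :=
    (ContinuousLinearMap.contDiff (E := E [⋀^Fin 2]→L[ℝ] ℂ) (F := E →L[ℝ] E →L[ℝ] ℂ)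
      curry2).comp_contDiffOn (hs x₀)
  exact ((wedge2 E k).contDiff.comp_contDiffOn h1).clm_apply (hβ x₀)

theorem extD_wedgeForm [FiniteDimensional ℝ E] [IsManifold 𝓘(ℝ, E) ∞ M] {s : FormField E M ℂ 2}
    {β : FormField E M ℂ k} (hs : IsSmoothForm s) (hβ : IsSmoothForm β) (hd : extD s = 0) :
    extD (wedgeForm s β) = wedgeForm s (extD β) := by
  refine formField_ext fun x => ?_
  have hx := mem_chart_target E x
  rw [inChart_extD (hs.wedgeForm hβ) x hx, inChart_wedgeForm, inChart_wedgeForm]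
  beta_reduce
  rw [inChart_extD hβ x hx]
  refine extDeriv_wedge2 (hs.differentiableAt hx) (hβ.differentiableAt hx) ?_
  rw [← inChart_extD hs x hx, hd, inChart_zero]
  rfl

/-- The component of degree `k` of a family of forms. -/
def component (A : M → TotalForm E) (k : ℕ) : FormField E M ℂ k := fun x => A x k

/-- Smooth families of forms. -/
def IsSmoothTotal (A : M → TotalForm E) : Prop := ∀ k, IsSmoothForm (component A k)

/-- The exterior derivative, in all degrees. -/
def totalD (A : M → TotalForm E) : M → TotalForm E := fun x k =>
  match k with
  | 0 => 0
  | k + 1 => extD (component A k) x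

/-- The operator `lefschetz` on families of forms. -/
def lefschetzField (s : FormField E M ℂ 2) (A : M → TotalForm E) : M → TotalForm E := fun x =>
  lefschetz (curry2 (modelForm s x)) (A x)

theorem IsSmoothForm.zero : IsSmoothForm (0 : FormField E M F k) := fun x₀ => by
  rw [inChart_zero]
  exact contDiffOn_const

theorem IsSmoothTotal.lefschetzField {s : FormField E M ℂ 2} (hs : IsSmoothForm s)
    {A : M → TotalForm E} (hA : IsSmoothTotal A) : IsSmoothTotal (lefschetzField s A) := fun k =>
  match k with
  | 0 => IsSmoothForm.zero
  | 1 => IsSmoothForm.zero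
  | k + 2 => hs.wedgeForm (hA k)

variable [FiniteDimensional ℝ E] [IsManifold 𝓘(ℝ, E) ∞ M]

theorem totalD_lefschetzField {s : FormField E M ℂ 2} (hs : IsSmoothForm s) (hd : extD s = 0)
    {A : M → TotalForm E} (hA : IsSmoothTotal A) :
    totalD (lefschetzField s A) = lefschetzField s (totalD A) := by
  funext x k
  match k with
  | 0 => rfl
  | 1 => exact congrFun (extD_zero (E := E) (M := M)) x
  | 2 => exact (congrFun (extD_zero (E := E) (M := M)) x).trans (map_zero (wedge2 E 0 _)).symm
  | k + 3 => exact congrFun (extD_wedgeForm hs (hA k) hd) x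

/-- Used twice: to see that powers of `σ` are closed, and to turn a primitive of a form into one of
its product with `s^r`. -/
theorem lefschetzField_pow {s : FormField E M ℂ 2} (hs : IsSmoothForm s) (hd : extD s = 0)
    (r : ℕ) {A : M → TotalForm E} (hA : IsSmoothTotal A) :
    IsSmoothTotal (fun x => (lefschetz (curry2 (modelForm s x)) ^ r) (A x)) ∧
    totalD (fun x => (lefschetz (curry2 (modelForm s x)) ^ r) (A x)) =
      fun x => (lefschetz (curry2 (modelForm s x)) ^ r) (totalD A x) := by
  induction r with
  | zero => exact ⟨hA, rfl⟩
  | succ r ih =>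
    simp only [pow_succ', Module.End.mul_apply]
    refine ⟨ih.1.lefschetzField hs, (totalD_lefschetzField hs hd ih.1).trans ?_⟩
    rw [ih.2]
    rfl

omit [FiniteDimensional ℝ E] in
theorem totalD_smul (c : ℂ) {A : M → TotalForm E} (hA : IsSmoothTotal A) :
    IsSmoothTotal (fun x => c • A x) ∧
    totalD (fun x => c • A x) = fun x => c • totalD A x := by
  let g : ℂ →L[ℝ] ℂ := ContinuousLinearMap.lsmul ℝ ℂ c
  have h (k : ℕ) : component (fun x => c • A x) k = mapForm g (component A k) := by
    funext x; ext v; rfl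
  refine ⟨fun k => by rw [h]; exact (hA k).mapForm g, ?_⟩
  funext x k
  match k with
  | 0 => exact (smul_zero c).symm
  | k + 1 =>
    change extD (component (fun x => c • A x) k) x = _
    rw [h, extD_mapForm g (hA k)]
    ext v; rfl

omit [FiniteDimensional ℝ E] [IsManifold 𝓘(ℝ, E) ∞ M] in
theorem unitForm_closed :
    IsSmoothTotal (fun _ : M => unitForm E) ∧ totalD (fun _ : M => unitForm E) = 0 := by
  have h (k : ℕ) (x₀ : M) :
      inChart (component (fun _ : M => unitForm E) k) x₀ = fun _ => unitForm E k := by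
    funext y; ext v
    match k with
    | 0 => rfl
    | k + 1 => rfl
  have hs : IsSmoothTotal (fun _ : M => unitForm E) := fun k x₀ => by
    rw [h]
    exact contDiffOn_const
  refine ⟨hs, ?_⟩
  funext x k
  match k with
  | 0 => rfl
  | k + 1 =>
    have h0 : extDeriv (inChart (component (fun _ : M => unitForm E) k) x) (chartAt E x x) = 0 := by
      rw [h, extDeriv, fderiv_const_apply]
      exact map_zero (ContinuousAlternatingMap.alternatizeUncurryFinCLM ℝ E ℂ)
    change extD (component (fun _ : M => unitForm E) k) x = 0
    rw [extD, h0]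
    rfl

-- Treats degree `0` together with the others: there the only exact form is `0`, which agrees with
-- `totalD` having zero component in degree `0`.
omit [FiniteDimensional ℝ E] in
theorem exists_total_of_exact {k : ℕ} {α : SmoothForm E M ℝ k} (hα : α ∈ exactForms E M ℝ k) :
    ∃ H : M → TotalForm E, IsSmoothTotal H ∧
      ∀ x, totalD H x k = mapForm Complex.ofRealCLM α.1 x := by
  match k with
  | 0 =>
    rw [(Submodule.mem_bot ℝ).1 hα]
    refine ⟨0, fun k => IsSmoothForm.zero, fun x => ?_⟩
    ext v; rfl
  | k + 1 =>
    obtain ⟨η, rfl⟩ := hα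
    let H : M → TotalForm E := fun x =>
      Pi.single k (modelForm (mapForm Complex.ofRealCLM η.1) x)
    have hk : component H k = mapForm Complex.ofRealCLM η.1 := by
      funext x
      exact Pi.single_eq_same _ _
    refine ⟨H, fun j => ?_, fun x => ?_⟩
    · by_cases hj : j = k
      · subst hj
        rw [hk]
        exact IsSmoothForm.mapForm _ η.2
      · have : component H j = 0 := by
          funext x
          exact Pi.single_eq_of_ne hj _
        rw [this]
        exact IsSmoothForm.zero
    · change extD (component H k) x = _
      rw [hk, extD_mapForm _ η.2]
      rfl

end Fields

open MeasureTheory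

/-! ### Stokes' theorem on a vector space, and orientation signs -/

section Flat

variable {E : Type*} [NormedAddCommGroup E] [NormedSpace ℝ E]

theorem contDiff_indicator_of_compact {X : Type*} [NormedAddCommGroup X] [NormedSpace ℝ X]
    {f : E → X} {U K : Set E} (hU : IsOpen U) (hK : IsCompact K) (hKU : K ⊆ U)
    (hf : ContDiffOn ℝ ∞ f U) (h0 : ∀ y ∈ U, y ∉ K → f y = 0) :
    ContDiff ℝ ∞ (U.indicator f) ∧ HasCompactSupport (U.indicator f) := by
  have hzero : ∀ y ∉ K, U.indicator f y = 0 := fun y hy => by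
    by_cases hyU : y ∈ U
    · rw [indicator_of_mem hyU, h0 y hyU hy]
    · exact indicator_of_notMem hyU f
  refine ⟨contDiff_iff_contDiffAt.2 fun y => ?_, HasCompactSupport.intro hK hzero⟩
  by_cases hy : y ∈ K
  · refine (hf.contDiffAt (hU.mem_nhds (hKU hy))).congr_of_eventuallyEq ?_
    filter_upwards [hU.mem_nhds (hKU hy)] with z hz
    exact indicator_of_mem hz f
  · refine (contDiffAt_const (c := (0 : X))).congr_of_eventuallyEq ?_
    filter_upwards [hK.isClosed.isOpen_compl.mem_nhds hy] with z hz
    exact hzero z hz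

variable [FiniteDimensional ℝ E] [MeasurableSpace E] [BorelSpace E] (μ : Measure E)
  [μ.IsAddHaarMeasure]

/-- Integration by parts against the constant function `1`. -/
theorem integral_fderiv_eq_zero {g : E → ℝ} (hg : ContDiff ℝ ∞ g) (hc : HasCompactSupport g)
    (v : E) : ∫ y, fderiv ℝ g y v ∂μ = 0 := by
  have hg' : Continuous fun y => fderiv ℝ g y v :=
    (hg.continuous_fderiv (by simp)).clm_apply continuous_const
  have hc' : HasCompactSupport fun y => fderiv ℝ g y v := hc.fderiv_apply ℝ v
  have h := integral_mul_fderiv_eq_neg_fderiv_mul_of_integrable (μ := μ) (f := fun _ : E => (1 : ℝ))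
    (g := g) (v := v) (by simp)
    (by simpa using hg'.integrable_of_hasCompactSupport hc')
    (by simpa using hg.continuous.integrable_of_hasCompactSupport hc)
    (fun y _ => differentiableAt_const _) (fun y _ => hg.differentiable (by simp) y)
  simpa using h

/-- Stokes' theorem for compactly supported forms on a vector space. -/
theorem integral_extDeriv_eq_zero {m : ℕ} {G : E → E [⋀^Fin m]→L[ℝ] ℝ} (hG : ContDiff ℝ ∞ G)
    (hc : HasCompactSupport G) (v : Fin (m + 1) → E) : ∫ y, extDeriv G y v ∂μ = 0 := by
  have hsm (w : Fin m → E) : ContDiff ℝ ∞ fun y => G y w :=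
    (ContinuousAlternatingMap.apply ℝ E ℝ w).contDiff.comp hG
  have hcs (w : Fin m → E) : HasCompactSupport fun y => G y w :=
    hc.comp_left (g := fun f : E [⋀^Fin m]→L[ℝ] ℝ => f w) rfl
  have h1 (y : E) := extDeriv_apply (hG.differentiable (by simp) y) v
  simp only [h1]
  rw [integral_finsetSum]
  · refine Finset.sum_eq_zero fun i _ => ?_
    have h2 := integral_fderiv_eq_zero μ (hsm (i.removeNth v)) (hcs _) (v i)
    rcases neg_one_pow_eq_or ℤ (i : ℕ) with h | h
    · simp only [h, one_smul, h2]
    · simp only [h, neg_smul, one_smul, integral_neg, h2, neg_zero]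
  · intro i _
    have hcont : Continuous fun y => fderiv ℝ (fun z => G z (i.removeNth v)) y (v i) :=
      ((hsm _).continuous_fderiv (by simp)).clm_apply continuous_const
    have hint := hcont.integrable_of_hasCompactSupport (μ := μ) ((hcs _).fderiv_apply ℝ (v i))
    rcases neg_one_pow_eq_or ℤ (i : ℕ) with h | h
    · simpa only [h, one_smul] using hint
    · simp only [h, neg_smul, one_smul]
      exact hint.neg

omit [FiniteDimensional ℝ E] [MeasurableSpace E] [BorelSpace E] in
theorem compContinuousLinearMap_basis {ι : Type*} [Fintype ι] [DecidableEq ι]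
    (e : Module.Basis ι ℝ E) (α : E [⋀^ι]→L[ℝ] ℝ) (T : E →L[ℝ] E) :
    α.compContinuousLinearMap T e = T.det * α e := by
  have h := AlternatingMap.eq_smul_basis_det e α.toAlternatingMap
  have h1 := congrArg (fun f => f (T ∘ e)) h
  refine h1.trans ?_
  change α e * e.det (T.toLinearMap ∘ e) = _
  rw [Module.Basis.det_comp, e.det_self, mul_one, mul_comm]

/-- The sign of a real number, written so that it is multiplicative. -/
def orientSign (w : ℝ) : ℝ := w / |w|

theorem orientSign_mul_self {w : ℝ} : orientSign w * w = |w| := by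
  rcases eq_or_ne w 0 with rfl | hw
  · simp
  · rw [orientSign, div_mul_eq_mul_div, ← abs_mul_abs_self, mul_div_assoc,
      div_self (abs_ne_zero.2 hw), mul_one]

/-- With `d` the Jacobian determinant of a change of charts, this makes the signed coefficient of a
top form transform by `|d|`, even when the change of charts reverses orientation. -/
theorem orientSign_mul_mul (d w a : ℝ) :
    orientSign (d * w) * (d * a) = |d| * (orientSign w * a) := by
  rcases eq_or_ne d 0 with rfl | hd
  · simp
  · rw [← orientSign_mul_self (w := d)]
    simp only [orientSign, abs_mul, mul_div_mul_comm]
    ring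

omit [NormedSpace ℝ E] [FiniteDimensional ℝ E] [MeasurableSpace E] [BorelSpace E] in
theorem eventually_orientSign_eq {w : E → ℝ} {y : E} (hw : ContinuousAt w y) (h0 : w y ≠ 0) :
    ∀ᶠ z in 𝓝 y, orientSign (w z) = orientSign (w y) := by
  rcases lt_or_gt_of_ne h0 with h | h
  · filter_upwards [hw.eventually (gt_mem_nhds h)] with z hz
    rw [orientSign, orientSign, abs_of_neg hz, abs_of_neg h, div_neg, div_neg, div_self hz.ne,
      div_self h.ne]
  · filter_upwards [hw.eventually (lt_mem_nhds h)] with z hz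
    rw [orientSign, orientSign, abs_of_pos hz, abs_of_pos h, div_self hz.ne', div_self h.ne']

end Flat

/-! ### Integration over a chart, oriented by a nowhere vanishing top form -/

section Charts

variable {E : Type*} [NormedAddCommGroup E] [NormedSpace ℝ E]
  {M : Type*} [TopologicalSpace M] [ChartedSpace E M] {k m N : ℕ}

/-- The product of a function and a form. -/
def smulForm (r : M → ℝ) (β : FormField E M ℝ k) : FormField E M ℝ k := fun x => r x • β x

theorem IsSmoothForm.smulForm [IsManifold 𝓘(ℝ, E) ∞ M] {r : M → ℝ}
    (hr : ContMDiff 𝓘(ℝ, E) 𝓘(ℝ) ∞ r) {β : FormField E M ℝ k} (hβ : IsSmoothForm β) :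
    IsSmoothForm (smulForm r β) := fun x₀ => by
  have h1 : ContDiffOn ℝ ∞ (r ∘ (chartAt E x₀).symm) (chartAt E x₀).target :=
    contMDiffOn_iff_contDiffOn.1
      (hr.comp_contMDiffOn (contMDiffOn_chart_symm (I := 𝓘(ℝ, E)) (x := x₀)))
  exact h1.smul (hβ x₀)

theorem inChart_eq_zero {β : FormField E M ℝ k} {x₀ : M} {y : E}
    (h : β ((chartAt E x₀).symm y) = 0) : inChart β x₀ y = 0 := by
  rw [inChart, h]; rfl

theorem extD_eq_zero_of_notMem {β : FormField E M ℝ k} {K : Set M} (hK : IsClosed K)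
    (hβ : ∀ x ∉ K, β x = 0) : ∀ x ∉ K, extD β x = 0 := fun x hx => by
  have hx' := mem_chart_target E x
  have hev : inChart β x =ᶠ[𝓝 (chartAt E x x)] fun _ => 0 := by
    have h1 : (chartAt E x).symm (chartAt E x x) ∈ Kᶜ := by
      rwa [(chartAt E x).left_inv (mem_chart_source E x)]
    filter_upwards [((chartAt E x).continuousAt_symm hx').preimage_mem_nhds
        (hK.isOpen_compl.mem_nhds h1)] with z hz
    exact inChart_eq_zero (hβ _ hz)
  have h : extDeriv (inChart β x) (chartAt E x x) = 0 := by
    rw [hev.extDeriv_eq, extDeriv, fderiv_const_apply]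
    exact map_zero (ContinuousAlternatingMap.alternatizeUncurryFinCLM ℝ E ℝ)
  rw [extD, h]
  rfl

/-- The coefficient in a chart of a form of top degree. -/
def coeffInChart (e : Fin N → E) (Ω : FormField E M ℝ N) (x₀ : M) (y : E) : ℝ := inChart Ω x₀ y e

/-- A form in a chart, with the sign given by the orientation defined by `Ω`, extended by zero
outside the chart. -/
def orientedInChart (e : Fin N → E) (Ω : FormField E M ℝ N) (x₀ : M) (β : FormField E M ℝ k) :
    E → E [⋀^Fin k]→L[ℝ] ℝ :=
  (chartAt E x₀).target.indicator fun y => orientSign (coeffInChart e Ω x₀ y) • inChart β x₀ y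

theorem IsSmoothForm.coeffInChart {Ω : FormField E M ℝ N} (hΩ : IsSmoothForm Ω) (e : Fin N → E)
    (x₀ : M) : ContDiffOn ℝ ∞ (coeffInChart e Ω x₀) (chartAt E x₀).target :=
  (ContinuousAlternatingMap.apply ℝ E ℝ e).contDiff.comp_contDiffOn (hΩ x₀)

theorem coeffInChart_ne_zero [IsManifold 𝓘(ℝ, E) ∞ M] (e : Module.Basis (Fin N) ℝ E)
    {Ω : FormField E M ℝ N} (hΩ : ∀ x, Ω x ≠ 0) {x₀ : M} {y : E}
    (hy : y ∈ (chartAt E x₀).target) : coeffInChart e Ω x₀ y ≠ 0 := fun h => by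
  have : IsManifold 𝓘(ℝ, E) 1 M := .of_le (n := ∞) (by simp)
  have h0 : inChart Ω x₀ y = 0 := by
    have h1 := AlternatingMap.eq_smul_basis_det e (inChart Ω x₀ y).toAlternatingMap
    ext v
    refine (congrArg (fun f => f v) h1).trans ?_
    change coeffInChart e Ω x₀ y * _ = 0
    rw [h, zero_mul]
  refine hΩ ((chartAt E x₀).symm y) ?_
  have hinv' := (mdifferentiable_chart (I := 𝓘(ℝ, E)) x₀).symm_comp_deriv
    ((chartAt E x₀).map_target hy)
  rw [(chartAt E x₀).right_inv hy] at hinv'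
  ext v
  have h2 := congrArg (fun f => f fun i => mfderiv 𝓘(ℝ, E) 𝓘(ℝ, E) (chartAt E x₀)
    ((chartAt E x₀).symm y) (v i)) h0
  refine Eq.trans ?_ h2
  refine congrArg (Ω ((chartAt E x₀).symm y)) ?_
  funext i
  exact (DFunLike.congr_fun hinv' (v i)).symm

variable [IsManifold 𝓘(ℝ, E) ∞ M]

/-- The sign does not destroy smoothness: the coefficient of `Ω` is continuous without zeros, so its
sign is locally constant on the chart. -/
theorem orientedInChart_contDiff (e : Module.Basis (Fin N) ℝ E) {Ω : FormField E M ℝ N}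
    (hΩ : IsSmoothForm Ω) (hΩ0 : ∀ x, Ω x ≠ 0) {x₀ : M} {β : FormField E M ℝ k}
    (hβ : IsSmoothForm β) {K : Set M} (hK : IsCompact K) (hKs : K ⊆ (chartAt E x₀).source)
    (hβ0 : ∀ x ∉ K, β x = 0) :
    ContDiff ℝ ∞ (orientedInChart e Ω x₀ β) ∧ HasCompactSupport (orientedInChart e Ω x₀ β) := by
  refine contDiff_indicator_of_compact (chartAt E x₀).open_target
    (hK.image_of_continuousOn ((chartAt E x₀).continuousOn.mono hKs)) ?_ ?_ ?_
  · rintro _ ⟨x, hx, rfl⟩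
    exact (chartAt E x₀).map_source (hKs hx)
  · intro y hy
    have hy' := (chartAt E x₀).open_target.mem_nhds hy
    refine ContDiffAt.contDiffWithinAt (ContDiffAt.congr_of_eventuallyEq
      (f := fun z => orientSign (coeffInChart e Ω x₀ y) • inChart β x₀ z)
      (((hβ x₀).contDiffAt hy').const_smul _) ?_)
    filter_upwards [eventually_orientSign_eq
      ((hΩ.coeffInChart e x₀).contDiffAt hy').continuousAt (coeffInChart_ne_zero e hΩ0 hy)]
      with z hz
    rw [hz]
  · intro y hy hyK
    have : (chartAt E x₀).symm y ∉ K := fun h => hyK ⟨_, h, (chartAt E x₀).right_inv hy⟩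
    rw [inChart_eq_zero (hβ0 _ this), smul_zero]

variable [MeasurableSpace E] [BorelSpace E] (μ : Measure E)

/-- The integral over a chart of a form of top degree. -/
def chartIntegral (e : Fin N → E) (Ω : FormField E M ℝ N) (x₀ : M) (α : FormField E M ℝ N) : ℝ :=
  ∫ y, orientedInChart e Ω x₀ α y e ∂μ

omit [IsManifold 𝓘(ℝ, E) ∞ M] in
theorem chartIntegral_eq (e : Fin N → E) (Ω : FormField E M ℝ N) (x₀ : M)
    (α : FormField E M ℝ N) : chartIntegral μ e Ω x₀ α =
      ∫ y in (chartAt E x₀).target,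
        orientSign (coeffInChart e Ω x₀ y) * coeffInChart e α x₀ y ∂μ := by
  rw [chartIntegral, ← integral_indicator (chartAt E x₀).open_target.measurableSet]
  congr 1
  funext y
  by_cases hy : y ∈ (chartAt E x₀).target
  · rw [orientedInChart, indicator_of_mem hy, indicator_of_mem hy]
    rfl
  · rw [orientedInChart, indicator_of_notMem hy, indicator_of_notMem hy]
    rfl

variable [FiniteDimensional ℝ E] [μ.IsAddHaarMeasure]

omit [MeasurableSpace E] [BorelSpace E] [FiniteDimensional ℝ E] in
theorem coeffInChart_change (e : Module.Basis (Fin N) ℝ E) (α : FormField E M ℝ N) {x₀ x₁ : M}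
    {z : E} (hz : z ∈ (chartAt E x₀).target)
    (hz' : (chartAt E x₀).symm z ∈ (chartAt E x₁).source) :
    coeffInChart e α x₀ z = (fderiv ℝ ((chartAt E x₁) ∘ (chartAt E x₀).symm) z).det *
      coeffInChart e α x₁ (((chartAt E x₁) ∘ (chartAt E x₀).symm) z) := by
  rw [coeffInChart, inChart_eq_pullback α x₀ x₁ hz hz', compContinuousLinearMap_basis]
  rfl

/-- The integral of a form supported in two charts is the same in both charts. -/
theorem chartIntegral_change (e : Module.Basis (Fin N) ℝ E) (Ω : FormField E M ℝ N) (x₀ x₁ : M)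
    {α : FormField E M ℝ N} (h0 : ∀ x ∉ (chartAt E x₀).source, α x = 0)
    (h1 : ∀ x ∉ (chartAt E x₁).source, α x = 0) :
    chartIntegral μ e Ω x₀ α = chartIntegral μ e Ω x₁ α := by
  set τ := (chartAt E x₀).symm.trans (chartAt E x₁) with hτ
  have hsrc (z : E) : z ∈ τ.source ↔
      z ∈ (chartAt E x₀).target ∧ (chartAt E x₀).symm z ∈ (chartAt E x₁).source := by
    rw [hτ, OpenPartialHomeomorph.trans_source]
    exact Iff.rfl
  have htgt (z : E) : z ∈ τ.target ↔
      z ∈ (chartAt E x₁).target ∧ (chartAt E x₁).symm z ∈ (chartAt E x₀).source := by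
    rw [hτ, OpenPartialHomeomorph.trans_target]
    exact Iff.rfl
  -- `α` vanishes off both chart domains, so each integral reduces to the overlap, where the change
  -- of variables applies.
  have e0 : chartIntegral μ e Ω x₀ α = ∫ y in τ.source,
      orientSign (coeffInChart e Ω x₀ y) * coeffInChart e α x₀ y ∂μ := by
    rw [chartIntegral_eq]
    refine setIntegral_eq_of_subset_of_forall_sdiff_eq_zero
      (chartAt E x₀).open_target.measurableSet (fun z hz => ((hsrc z).1 hz).1) fun z hz => ?_
    have : (chartAt E x₀).symm z ∉ (chartAt E x₁).source := fun h =>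
      hz.2 ((hsrc z).2 ⟨hz.1, h⟩)
    rw [coeffInChart, coeffInChart, inChart_eq_zero (h1 _ this)]
    exact mul_zero _
  have e1 : chartIntegral μ e Ω x₁ α = ∫ y in τ.target,
      orientSign (coeffInChart e Ω x₁ y) * coeffInChart e α x₁ y ∂μ := by
    rw [chartIntegral_eq]
    refine setIntegral_eq_of_subset_of_forall_sdiff_eq_zero
      (chartAt E x₁).open_target.measurableSet (fun z hz => ((htgt z).1 hz).1) fun z hz => ?_
    have : (chartAt E x₁).symm z ∉ (chartAt E x₀).source := fun h =>
      hz.2 ((htgt z).2 ⟨hz.1, h⟩)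
    rw [coeffInChart, coeffInChart, inChart_eq_zero (h0 _ this)]
    exact mul_zero _
  rw [e0, e1, ← τ.image_source_eq_target, integral_image_eq_integral_abs_det_fderiv_smul μ
    τ.open_source.measurableSet (f' := fderiv ℝ ((chartAt E x₁) ∘ (chartAt E x₀).symm)) ?_ τ.injOn]
  · refine setIntegral_congr_fun τ.open_source.measurableSet fun z hz => ?_
    obtain ⟨hz, hz'⟩ := (hsrc z).1 hz
    rw [coeffInChart_change e Ω hz hz', coeffInChart_change e α hz hz', orientSign_mul_mul]
    rfl
  · intro z hz
    obtain ⟨hz, hz'⟩ := (hsrc z).1 hz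
    exact ((contDiffAt_chartChange x₀ x₁ hz hz').differentiableAt
      (by simp)).hasFDerivAt.hasFDerivWithinAt

/-- Stokes' theorem for forms supported in a chart. -/
theorem chartIntegral_extD (e : Module.Basis (Fin (m + 1)) ℝ E) {Ω : FormField E M ℝ (m + 1)}
    (hΩ : IsSmoothForm Ω) (hΩ0 : ∀ x, Ω x ≠ 0) {x₀ : M} {β : FormField E M ℝ m}
    (hβ : IsSmoothForm β) {K : Set M} (hK : IsCompact K) (hKs : K ⊆ (chartAt E x₀).source)
    (hβ0 : ∀ x ∉ K, β x = 0) : chartIntegral μ e Ω x₀ (extD β) = 0 := by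
  obtain ⟨hG, hc⟩ := orientedInChart_contDiff e hΩ hΩ0 hβ hK hKs hβ0
  rw [← integral_extDeriv_eq_zero μ hG hc e, chartIntegral]
  congr 1
  funext y
  by_cases hy : y ∈ (chartAt E x₀).target
  · have hy' := (chartAt E x₀).open_target.mem_nhds hy
    have hev : orientedInChart e Ω x₀ β =ᶠ[𝓝 y]
        orientSign (coeffInChart e Ω x₀ y) • inChart β x₀ := by
      filter_upwards [hy', eventually_orientSign_eq
        ((hΩ.coeffInChart e x₀).contDiffAt hy').continuousAt (coeffInChart_ne_zero e hΩ0 hy)]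
        with z hz hz'
      rw [orientedInChart, indicator_of_mem hz, hz']
      rfl
    rw [hev.extDeriv_eq, extDeriv_smul, orientedInChart, indicator_of_mem hy, inChart_extD hβ x₀ hy]
  -- Off the chart target, `y` is also off the closed support, which lies in the compact image of
  -- `K`. So the derivative of the extension by zero vanishes there too.
  · have hyK : y ∉ tsupport (orientedInChart e Ω x₀ β) := fun h => hy ?_
    · have h0 : extDeriv (orientedInChart e Ω x₀ β) y = 0 := by
        rw [extDeriv, fderiv_of_notMem_tsupport ℝ hyK]
        exact map_zero (ContinuousAlternatingMap.alternatizeUncurryFinCLM ℝ E ℝ)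
      rw [h0, orientedInChart, indicator_of_notMem hy]
    · have hcomp := hK.image_of_continuousOn ((chartAt E x₀).continuousOn.mono hKs)
      have hsub : tsupport (orientedInChart e Ω x₀ β) ⊆ chartAt E x₀ '' K := by
        refine closure_minimal (fun z hz => ?_) hcomp.isClosed
        by_contra hzK
        refine hz ?_
        by_cases hzt : z ∈ (chartAt E x₀).target
        · have : (chartAt E x₀).symm z ∉ K := fun h => hzK ⟨_, h, (chartAt E x₀).right_inv hzt⟩
          rw [orientedInChart, indicator_of_mem hzt, inChart_eq_zero (hβ0 _ this), smul_zero]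
        · exact indicator_of_notMem hzt _
      obtain ⟨x, hx, rfl⟩ := hsub h
      exact (chartAt E x₀).map_source (hKs hx)

omit [FiniteDimensional ℝ E] in
theorem chartIntegral_sum (e : Module.Basis (Fin N) ℝ E) {Ω : FormField E M ℝ N}
    (hΩ : IsSmoothForm Ω) (hΩ0 : ∀ x, Ω x ≠ 0) {x₀ : M} {ι : Type*} (s : Finset ι)
    (β : ι → FormField E M ℝ N) (hβ : ∀ i ∈ s, IsSmoothForm (β i)) {K : Set M} (hK : IsCompact K)
    (hKs : K ⊆ (chartAt E x₀).source) (hβ0 : ∀ i ∈ s, ∀ x ∉ K, β i x = 0) :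
    chartIntegral μ e Ω x₀ (∑ i ∈ s, β i) = ∑ i ∈ s, chartIntegral μ e Ω x₀ (β i) := by
  simp only [chartIntegral]
  rw [← integral_finsetSum]
  · congr 1
    funext y
    by_cases hy : y ∈ (chartAt E x₀).target
    · have h (α : FormField E M ℝ N) : orientedInChart e Ω x₀ α y e =
          orientSign (coeffInChart e Ω x₀ y) * α ((chartAt E x₀).symm y)
            (fun i => mfderiv 𝓘(ℝ, E) 𝓘(ℝ, E) (chartAt E x₀).symm y (e i)) := by
        rw [orientedInChart, indicator_of_mem hy]
        rfl
      simp only [h]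
      rw [Finset.sum_apply, ContinuousAlternatingMap.sum_apply, Finset.mul_sum]
    · simp only [orientedInChart, indicator_of_notMem hy]
      exact (Finset.sum_const_zero).symm
  · intro i hi
    obtain ⟨hG, hc⟩ := orientedInChart_contDiff e hΩ hΩ0 (hβ i hi) hK hKs (hβ0 i hi)
    exact ((ContinuousAlternatingMap.apply ℝ E ℝ e).continuous.comp
      hG.continuous).integrable_of_hasCompactSupport
        (hc.comp_left (g := fun f : E [⋀^Fin N]→L[ℝ] ℝ => f e) rfl)

end Charts

/-! ### Volume forms on a compact manifold are not exact -/

section Global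

variable {E : Type*} [NormedAddCommGroup E] [NormedSpace ℝ E] [FiniteDimensional ℝ E]
  {M : Type*} [TopologicalSpace M] [ChartedSpace E M] [IsManifold 𝓘(ℝ, E) ∞ M] {k m N : ℕ}

omit [FiniteDimensional ℝ E] in
theorem extD_sum {ι : Type*} (s : Finset ι) (β : ι → FormField E M ℝ k)
    (hβ : ∀ i, IsSmoothForm (β i)) : extD (∑ i ∈ s, β i) = ∑ i ∈ s, extD (β i) := by
  let b : ι → SmoothForm E M ℝ k := fun i => ⟨β i, hβ i⟩
  have h := congrArg Subtype.val (map_sum (d E M ℝ k) b s)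
  have h1 : (∑ i ∈ s, b i).1 = ∑ i ∈ s, β i := map_sum (smoothForms E M ℝ k).subtype b s
  have h2 : (∑ i ∈ s, d E M ℝ k (b i)).1 = ∑ i ∈ s, extD (β i) :=
    map_sum (smoothForms E M ℝ (k + 1)).subtype (fun i => d E M ℝ k (b i)) s
  rw [h2] at h
  rw [← h, ← h1]
  rfl

/-- On a compact manifold, a nowhere vanishing form of top degree is not exact. -/
theorem extD_ne_of_forall_ne_zero [T2Space M] [CompactSpace M] [Nonempty M]
    (hm : Module.finrank ℝ E = m + 1) {Ω : FormField E M ℝ (m + 1)} (hΩ : IsSmoothForm Ω)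
    (hΩ0 : ∀ x, Ω x ≠ 0) {η : FormField E M ℝ m} (hη : IsSmoothForm η) : extD η ≠ Ω := by
  intro hex
  let _ : MeasurableSpace E := borel E
  have _ : BorelSpace E := ⟨rfl⟩
  let μ : Measure E := Measure.addHaar
  let e : Module.Basis (Fin (m + 1)) ℝ E := Module.finBasisOfFinrankEq ℝ E hm
  obtain ⟨ρ, hρ⟩ := SmoothPartitionOfUnity.exists_isSubordinate_chartAt_source 𝓘(ℝ, E) M
  have hfin : {i | (Function.support (ρ i)).Nonempty}.Finite :=
    ρ.locallyFinite.finite_nonempty_of_compact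
  set s := hfin.toFinset
  have hsum (x : M) : ∑ i ∈ s, ρ i x = 1 := by
    rw [← ρ.sum_eq_one (mem_univ x)]
    refine (finsum_eq_sum_of_support_subset _ fun i hi => ?_).symm
    exact hfin.mem_toFinset.2 ⟨x, hi⟩
  have hpart {k : ℕ} (β : FormField E M ℝ k) : ∑ i ∈ s, smulForm (ρ i) β = β := by
    funext x
    rw [Finset.sum_apply]
    change ∑ i ∈ s, ρ i x • β x = β x
    rw [← Finset.sum_smul, hsum, one_smul]
  have hK (i : M) : IsCompact (tsupport (ρ i)) := (isClosed_tsupport _).isCompact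
  have hzero {k : ℕ} (i : M) (β : FormField E M ℝ k) :
      ∀ x ∉ tsupport (ρ i), smulForm (ρ i) β x = 0 := fun x hx => by
    rw [smulForm, image_eq_zero_of_notMem_tsupport hx, zero_smul]
  have hsm {k : ℕ} (i : M) {β : FormField E M ℝ k} (hβ : IsSmoothForm β) :
      IsSmoothForm (smulForm (ρ i) β) := hβ.smulForm (ρ i).contMDiff
  have hdη (i : M) : IsSmoothForm (extD (smulForm (ρ i) η)) := (hsm i hη).extD
  have hdη0 (i : M) := extD_eq_zero_of_notMem (isClosed_tsupport (ρ i)) (hzero i η)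
  have hdη0' (i j : M) : ∀ x ∉ tsupport (ρ i),
      smulForm (ρ j) (extD (smulForm (ρ i) η)) x = 0 := fun x hx => by
    rw [smulForm, hdη0 i x hx, smul_zero]
  -- From `Ω = dη` and `η = ∑ ρ_i η`.
  have h1 (j : M) : smulForm (ρ j) Ω = ∑ i ∈ s, smulForm (ρ j) (extD (smulForm (ρ i) η)) := by
    rw [← hex]
    conv_lhs => rw [← hpart η, extD_sum _ _ fun i => hsm i hη]
    funext x
    rw [Finset.sum_apply, smulForm, Finset.sum_apply, Finset.smul_sum]
    rfl
  -- The form `ρ_j d(ρ_i η)` is supported in both charts, so its integral may be moved from chart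
  -- `j` to chart `i`. Summing over `j` first removes `ρ_j` and leaves the integral of `d(ρ_i η)`,
  -- which is zero.
  have htotal : ∑ j ∈ s, chartIntegral μ e Ω j (smulForm (ρ j) Ω) = 0 := by
    have h2 (j : M) : chartIntegral μ e Ω j (smulForm (ρ j) Ω) =
        ∑ i ∈ s, chartIntegral μ e Ω i (smulForm (ρ j) (extD (smulForm (ρ i) η))) := by
      rw [h1, chartIntegral_sum μ e hΩ hΩ0 s _ (fun i _ => hsm j (hdη i)) (hK j) (hρ j)
        fun i _ => hzero j _]
      refine Finset.sum_congr rfl fun i _ => ?_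
      exact chartIntegral_change μ e Ω j i (fun x hx => hzero j _ x fun h => hx (hρ j h))
        (fun x hx => hdη0' i j x fun h => hx (hρ i h))
    simp only [h2]
    rw [Finset.sum_comm]
    refine Finset.sum_eq_zero fun i _ => ?_
    rw [← chartIntegral_sum μ e hΩ hΩ0 s _ (fun j _ => hsm j (hdη i)) (hK i) (hρ i)
        fun j _ => hdη0' i j, hpart]
    exact chartIntegral_extD μ e hΩ hΩ0 (hsm i hη) (hK i) (hρ i) (hzero i η)
  -- With the orientation given by `Ω` itself the integrand is `ρ_j |Ω|`, so the same total is
  -- positive.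
  have hint (j : M) (y : E) : orientedInChart e Ω j (smulForm (ρ j) Ω) y e =
      (chartAt E j).target.indicator
        (fun z => ρ j ((chartAt E j).symm z) * |coeffInChart e Ω j z|) y := by
    by_cases hy : y ∈ (chartAt E j).target
    · rw [orientedInChart, indicator_of_mem hy, indicator_of_mem hy, ← orientSign_mul_self,
        mul_left_comm]
      rfl
    · rw [orientedInChart, indicator_of_notMem hy, indicator_of_notMem hy]
      rfl
  have hnonneg (j : M) (y : E) : 0 ≤ orientedInChart e Ω j (smulForm (ρ j) Ω) y e := by
    rw [hint]
    exact indicator_nonneg (fun z _ => mul_nonneg (ρ.nonneg j _) (abs_nonneg _)) y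
  obtain ⟨x⟩ := ‹Nonempty M›
  obtain ⟨j, hjs, hj⟩ : ∃ j ∈ s, ρ j x ≠ 0 := by
    by_contra! h
    exact one_ne_zero ((hsum x).symm.trans (Finset.sum_eq_zero h))
  have hjx : x ∈ (chartAt E j).source := hρ j (subset_tsupport _ hj)
  have hpos : 0 < chartIntegral μ e Ω j (smulForm (ρ j) Ω) := by
    obtain ⟨hG, hc⟩ := orientedInChart_contDiff e hΩ hΩ0 (hsm j hΩ) (hK j) (hρ j) (hzero j Ω)
    refine Continuous.integral_pos_of_hasCompactSupport_nonneg_nonzero (x := chartAt E j x)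
      ((ContinuousAlternatingMap.apply ℝ E ℝ e).continuous.comp hG.continuous)
      (hc.comp_left (g := fun f : E [⋀^Fin (m + 1)]→L[ℝ] ℝ => f e) rfl) (hnonneg j) ?_
    have hjt := (chartAt E j).map_source hjx
    change orientedInChart e Ω j (smulForm (ρ j) Ω) (chartAt E j x) e ≠ 0
    rw [hint, indicator_of_mem hjt, (chartAt E j).left_inv hjx]
    exact mul_ne_zero hj (abs_ne_zero.2 (coeffInChart_ne_zero e hΩ0 hjt))
  exact (Finset.sum_pos' (fun i _ => integral_nonneg (hnonneg i)) ⟨j, hjs, hpos⟩).ne' htotal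

end Global

/-! ### The volume form of a complex symplectic structure -/

section ComplexSymplecticForms

variable {E : Type*} [NormedAddCommGroup E] [NormedSpace ℝ E] [FiniteDimensional ℝ E]
  {M : Type*} [TopologicalSpace M] [ChartedSpace E M] [IsManifold 𝓘(ℝ, E) ∞ M] {n : ℕ}

namespace ComplexSymplecticStructure

variable (S : ComplexSymplecticStructure E M)

omit [FiniteDimensional ℝ E] in
theorem isSymplecticCovector (x : M) :
    IsSymplecticCovector (V := E) (S.J.toFun x) (modelForm S.form.1 x) :=
  ⟨map_left_of_mem_bidegree (V := E) (S.bidegree x), S.nondegenerate x⟩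

/-- The conjugate of the symplectic form. -/
def conj : FormField E M ℂ 2 := mapForm (Complex.conjCLE : ℂ →L[ℝ] ℂ) S.form.1

omit [FiniteDimensional ℝ E] in
theorem extD_form : extD S.form.1 = 0 := congrArg Subtype.val S.closed

omit [FiniteDimensional ℝ E] in
theorem isSmoothForm_conj : IsSmoothForm S.conj := IsSmoothForm.mapForm _ S.form.2

omit [FiniteDimensional ℝ E] in
theorem extD_conj : extD S.conj = 0 := by
  rw [conj, extD_mapForm _ S.form.2, extD_form]
  funext x; ext v
  exact map_zero (starRingEnd ℂ)

open IsSymplecticCovector in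
theorem powers_closed (i j : ℕ) :
    IsSmoothTotal (fun x => powers (modelForm S.form.1 x) i j) ∧
      totalD (fun x => powers (modelForm S.form.1 x) i j) = 0 := by
  obtain ⟨h0, h0'⟩ := unitForm_closed (E := E) (M := M)
  obtain ⟨h1, h1'⟩ := lefschetzField_pow S.isSmoothForm_conj S.extD_conj j h0
  obtain ⟨h2, h2'⟩ := lefschetzField_pow S.form.2 S.extD_form i h1
  refine ⟨h2, h2'.trans ?_⟩
  rw [h1', h0']
  funext x
  exact (congrArg _ (map_zero _)).trans (map_zero _)

open IsSymplecticCovector in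
/-- The volume form of a complex symplectic structure is real and vanishes nowhere. -/
theorem re_powers_ne_zero {N : ℕ} (hN : Module.finrank ℝ E = N) (hn : N = 4 * n) (x : M) :
    Complex.reCLM.compContinuousAlternatingMap
      ((((2 * n).choose n : ℂ) • powers (modelForm S.form.1 x) n n) N) ≠ 0 := by
  subst hn
  have hS := S.isSymplecticCovector x
  set s := modelForm S.form.1 x
  rw [← hS.lefschetz_pow_eq_smul_powers hN]
  have hne := lefschetz_pow_ne_zero (curry2_swap (s + conjForm s)) hS.exists_curry2_eq
    (r := 2 * n) (by omega)
  rw [show 2 * (2 * n) = 4 * n by ring] at hne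
  -- The form is fixed by conjugation, so its imaginary part is zero; if its real part were also
  -- zero, it would vanish.
  have hconj : conjTotal ((lefschetz (curry2 (s + conjForm s)) ^ (2 * n)) (unitForm E)) =
      (lefschetz (curry2 (s + conjForm s)) ^ (2 * n)) (unitForm E) := by
    rw [conjTotal_lefschetz_pow, conjForm_add_conjForm, conjTotal_unitForm]
  intro h
  refine hne ?_
  ext v
  refine Complex.ext (congrArg (fun f => f v) h) ?_
  have h1 := congrArg (fun t : TotalForm E => (t (4 * n) v).im) hconj
  change -((lefschetz (curry2 (s + conjForm s)) ^ (2 * n)) (unitForm E) (4 * n) v).im = _ at h1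
  change _ = (0 : ℝ)
  linarith

open IsSymplecticCovector in
/-- The volume form of a complex symplectic structure is not exact. -/
theorem exists_totalD_ne_powers [T2Space M] [CompactSpace M] [Nonempty M] {N : ℕ}
    (hN : Module.finrank ℝ E = N) (hn : N = 4 * n) {H : M → TotalForm E} (hH : IsSmoothTotal H) :
    ∃ x, totalD H x N ≠ powers (modelForm S.form.1 x) n n N := by
  by_contra! h
  obtain ⟨hs, hd⟩ := totalD_smul ((2 * n).choose n : ℂ) hH
  obtain ⟨hp, -⟩ := totalD_smul ((2 * n).choose n : ℂ) (S.powers_closed n n).1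
  set H' : M → TotalForm E := fun x => ((2 * n).choose n : ℂ) • H x
  have h' (x : M) : totalD H' x N =
      (((2 * n).choose n : ℂ) • powers (modelForm S.form.1 x) n n) N := by
    rw [hd]
    exact congrArg (((2 * n).choose n : ℂ) • ·) (h x)
  -- In degree `0` there are no primitives and `totalD` is zero, so non-vanishing at one point
  -- suffices. In positive degree Stokes' theorem is applied to real parts.
  match N with
  | 0 =>
    obtain ⟨x⟩ := ‹Nonempty M›
    refine S.re_powers_ne_zero hN hn x ?_
    rw [← h']
    ext v; rfl
  | m + 1 =>
    refine extD_ne_of_forall_ne_zero hN (IsSmoothForm.mapForm Complex.reCLM (hp (m + 1)))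
      (fun x => S.re_powers_ne_zero hN hn x) (IsSmoothForm.mapForm Complex.reCLM (hs m)) ?_
    rw [extD_mapForm _ (hs m)]
    funext x
    exact congrArg Complex.reCLM.compContinuousAlternatingMap (h' x)

end ComplexSymplecticStructure

end ComplexSymplecticForms

/-! ### Independence of the classes and the bounds -/

namespace ComplexSymplecticStructure

open IsSymplecticCovector

variable {E : Type*} [NormedAddCommGroup E] [NormedSpace ℝ E] [FiniteDimensional ℝ E]
  {M : Type*} [TopologicalSpace M] [ChartedSpace E M] [IsManifold 𝓘(ℝ, E) ∞ M] {n : ℕ}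
  (S : ComplexSymplecticStructure E M)

/-- The component of degree `m` of the real part of `(1 + i) σ^i ∧ conj σ^j`. -/
def realPower (m i j : ℕ) : SmoothForm E M ℝ m :=
  ⟨mapForm Complex.reCLM
      (component (fun x => (1 + Complex.I) • powers (modelForm S.form.1 x) i j) m),
    IsSmoothForm.mapForm _ ((totalD_smul _ (S.powers_closed i j).1).1 m)⟩

theorem d_realPower (m i j : ℕ) : d E M ℝ m (S.realPower m i j) = 0 := by
  obtain ⟨hs, hd⟩ := totalD_smul (1 + Complex.I) (S.powers_closed i j).1
  refine Subtype.ext ((extD_mapForm _ (hs m)).trans ?_)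
  have h : extD (component (fun x => (1 + Complex.I) • powers (modelForm S.form.1 x) i j) m) =
      0 := by
    funext x
    have h1 := congrFun (congrFun hd x) (m + 1)
    rw [(S.powers_closed i j).2] at h1
    refine h1.trans ?_
    ext v
    exact mul_zero _
  rw [h]
  funext x; ext v; rfl

/-- Twice a real combination of the forms `realPower` is a complex combination of the products
`σ^i ∧ conj σ^j`, with coefficients that determine the original ones. -/
theorem ofReal_sum_realPower (m q p : ℕ) (a : Fin (p + 1) → ℝ) (x : M) :
    (2 : ℂ) • modelForm (mapForm Complex.ofRealCLM
        (∑ t, a t • S.realPower m (q + t) (q + p - t)).1) x =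
      (∑ t : Fin (p + 1), ((1 + Complex.I) * a t + (1 - Complex.I) * a t.rev) •
        powers (modelForm S.form.1 x) (q + t) (q + p - t)) m := by
  set s := modelForm S.form.1 x
  set B : TotalForm E := ∑ t : Fin (p + 1), ((1 + Complex.I) * a t) • powers s (q + t) (q + p - t)
  -- Conjugation exchanges the exponents `q + t` and `q + p - t`, that is, reverses the index `t`.
  -- Twice the real part is then `B + conj B`.
  have hB : conjTotal B = ∑ t : Fin (p + 1),
      ((1 - Complex.I) * a t.rev) • powers s (q + t) (q + p - t) := by
    let c : TotalForm E →+ TotalForm E :=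
      { toFun := conjTotal
        map_zero' := by funext k; ext v; exact map_zero (starRingEnd ℂ)
        map_add' := conjTotal_add }
    change c B = _
    rw [map_sum, ← Equiv.sum_comp Fin.revPerm]
    refine Finset.sum_congr rfl fun t _ => ?_
    have ht : (t : ℕ) ≤ p := Nat.lt_succ_iff.1 t.2
    change conjTotal _ = _
    rw [conjTotal_smul, conjTotal_powers, Fin.revPerm_apply, Fin.val_rev, map_mul, map_add,
      map_one, Complex.conj_I, Complex.conj_ofReal, ← sub_eq_add_neg]
    congr 2 <;> omega
  have hsum : (∑ t : Fin (p + 1), ((1 + Complex.I) * a t + (1 - Complex.I) * a t.rev) •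
      powers s (q + t) (q + p - t)) = B + conjTotal B := by
    rw [hB, ← Finset.sum_add_distrib]
    exact Finset.sum_congr rfl fun t _ => add_smul _ _ _
  rw [hsum]
  have h1 : (∑ t, a t • S.realPower m (q + t) (q + p - t)).1 =
      ∑ t, a t • (S.realPower m (q + t) (q + p - t)).1 :=
    map_sum (smoothForms E M ℝ m).subtype _ _
  have h2 (v : Fin m → E) : modelForm (∑ t, a t • S.realPower m (q + t) (q + p - t)).1 x v =
      (B m v).re := by
    rw [h1]
    have h3 : modelForm (∑ t, a t • (S.realPower m (q + t) (q + p - t)).1) x v =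
        ∑ t, a t * modelForm (S.realPower m (q + t) (q + p - t)).1 x v := by
      rw [modelForm, Finset.sum_apply]
      exact ContinuousAlternatingMap.sum_apply _ _
    have hBv : B m v =
        ∑ t, ((1 + Complex.I) * a t) * powers s (q + t) (q + p - t) m v := by
      change (∑ t : Fin (p + 1),
        ((1 + Complex.I) * a t) • powers s (q + t) (q + p - t)) m v = _
      rw [Finset.sum_apply, ContinuousAlternatingMap.sum_apply]
      rfl
    rw [h3, hBv, Complex.re_sum]
    refine Finset.sum_congr rfl fun t _ => ?_
    change a t * ((1 + Complex.I) * powers s (q + t) (q + p - t) m v).re =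
      ((1 + Complex.I) * a t * powers s (q + t) (q + p - t) m v).re
    rw [← Complex.re_ofReal_mul]
    congr 1; ring
  ext v
  change (2 : ℂ) * ((modelForm (∑ t, a t • S.realPower m (q + t) (q + p - t)).1 x v : ℝ) : ℂ) =
    B m v + starRingEnd ℂ (B m v)
  rw [h2, Complex.add_conj]
  push_cast; ring

/-- Multiplication by the powers complementary to the term `t₀` isolates its coefficient `c t₀`;
were it nonzero, dividing by it would give a primitive of `σ^n ∧ conj σ^n`. -/
theorem eq_zero_of_sum_realPower_exact [T2Space M] [CompactSpace M] [Nonempty M]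
    (hn : Module.finrank ℝ E = 4 * n) {q p m : ℕ} (hqp : q + p ≤ n) (hm : m = 2 * (2 * q + p))
    (a : Fin (p + 1) → ℝ)
    (h : ∑ t, a t • S.realPower m (q + t) (q + p - t) ∈ exactForms E M ℝ m) : a = 0 := by
  obtain ⟨H, hH, hHx⟩ := exists_total_of_exact h
  funext t₀
  have ht₀ : (t₀ : ℕ) ≤ p := Nat.lt_succ_iff.1 t₀.2
  set c : Fin (p + 1) → ℂ := fun t => (1 + Complex.I) * a t + (1 - Complex.I) * a t.rev
  have hc : c t₀ = 0 := by
    by_contra hc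
    obtain ⟨h1, h1'⟩ := totalD_smul 2 hH
    obtain ⟨h2, h2'⟩ := lefschetzField_pow S.isSmoothForm_conj S.extD_conj (n - q - p + t₀) h1
    obtain ⟨h3, h3'⟩ := lefschetzField_pow S.form.2 S.extD_form (n - q - t₀) h2
    obtain ⟨h4, h4'⟩ := totalD_smul (c t₀)⁻¹ h3
    -- The degree is kept in this shape so that `lefschetz_pow_congr` applies twice without
    -- transport.
    set N := m + 2 * (n - q - p + t₀) + 2 * (n - q - t₀) with hN
    have hNn : N = 4 * n := by omega
    obtain ⟨x, hx⟩ := S.exists_totalD_ne_powers (hn.trans hNn.symm) hNn h4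
    refine hx ?_
    have hS := S.isSymplecticCovector x
    rw [h4', h3', h2', h1']
    beta_reduce
    set s := modelForm S.form.1 x
    have hdeg : ((2 : ℂ) • totalD H x) m =
        (∑ t : Fin (p + 1), c t • powers s (q + t) (q + p - t)) m := by
      rw [← S.ofReal_sum_realPower]
      exact congrArg ((2 : ℂ) • ·) (hHx x)
    have hL : ((lefschetz (curry2 s) ^ (n - q - t₀))
        ((lefschetz (curry2 (conjForm s)) ^ (n - q - p + t₀)) ((2 : ℂ) • totalD H x))) N =
        (c t₀ • powers s n n) N := by
      rw [lefschetz_pow_congr _ (lefschetz_pow_congr _ hdeg), map_sum, map_sum,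
        Finset.sum_eq_single t₀]
      · rw [map_smul, map_smul, lefschetz_pow_powers,
          show n - q - t₀ + (q + t₀) = n by omega,
          show n - q - p + t₀ + (q + p - t₀) = n by omega]
      · intro t _ ht
        have ht' : (t : ℕ) ≤ p := Nat.lt_succ_iff.1 t.2
        rw [map_smul, map_smul, lefschetz_pow_powers]
        -- The exponents are now `n + t - t₀` and `n + t₀ - t`; one of them exceeds `n` when `t ≠
        -- t₀`.
        rcases lt_or_gt_of_ne ht with ht | ht
        · have : (t : ℕ) < t₀ := ht
          rw [hS.powers_eq_zero_right _ (by omega), smul_zero]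
        · have : (t₀ : ℕ) < t := ht
          rw [hS.powers_eq_zero_left _ (by omega), smul_zero]
      · intro h
        exact absurd (Finset.mem_univ _) h
    refine (congrArg ((c t₀)⁻¹ • ·) hL).trans ?_
    rw [Pi.smul_apply, smul_smul, inv_mul_cancel₀ hc, one_smul]
  have hre := congrArg Complex.re hc
  have him := congrArg Complex.im hc
  -- `c t₀` has real part `a t₀ + a t₀.rev` and imaginary part `a t₀ - a t₀.rev`.
  simp [c] at hre him
  change a t₀ = 0
  linarith

theorem le_bettiNumber (S : ComplexSymplecticStructure E M) [T2Space M] [CompactSpace M]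
    [Nonempty M]
    (hn : Module.finrank ℝ E = 4 * n) {q p m : ℕ} (hqp : q + p ≤ n) (hm : m = 2 * (2 * q + p)) :
    ((p + 1 : ℕ) : Cardinal) ≤ bettiNumber E M m := by
  let z : Fin (p + 1) → LinearMap.ker (d E M ℝ m) := fun t =>
    ⟨S.realPower m (q + t) (q + p - t), S.d_realPower _ _ _⟩
  let P := (exactForms E M ℝ m).comap (LinearMap.ker (d E M ℝ m)).subtype
  have hli : LinearIndependent ℝ fun t => P.mkQ (z t) := by
    refine Fintype.linearIndependent_iff.2 fun a ha t => ?_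
    have h1 : P.mkQ (∑ t, a t • z t) = 0 := by
      rw [map_sum, ← ha]
      exact Finset.sum_congr rfl fun t _ => map_smul _ _ _
    have h2 : ∑ t, a t • z t ∈ P := (Submodule.Quotient.mk_eq_zero P).1 h1
    have h3 : (LinearMap.ker (d E M ℝ m)).subtype (∑ t, a t • z t) ∈ exactForms E M ℝ m := h2
    rw [map_sum] at h3
    exact congrFun (S.eq_zero_of_sum_realPower_exact hn hqp hm a h3) t
  have h := hli.cardinal_lift_le_rank
  rw [Cardinal.mk_fin, Cardinal.lift_natCast, Cardinal.lift_uzero] at h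
  exact h

end ComplexSymplecticStructure

end SmoothForms

end

theorem corollary5p2 {M : Type*} [TopologicalSpace M] [T2Space M] [CompactSpace M] [Nonempty M]
    (n : ℕ) [ChartedSpace (EuclideanSpace ℝ (Fin (4 * n))) M]
    [IsManifold 𝓘(ℝ, EuclideanSpace ℝ (Fin (4 * n))) ∞ M]
    (h : Nonempty
      (SmoothForms.ComplexSymplecticStructure (EuclideanSpace ℝ (Fin (4 * n))) M)) :
    (∀ k : ℕ, 1 ≤ k → k ≤ n →
      ((k + 1 : ℕ) : Cardinal) ≤
        SmoothForms.bettiNumber (EuclideanSpace ℝ (Fin (4 * n))) M (2 * k)) ∧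
    (∀ l : ℕ, n + 1 ≤ l → l ≤ 2 * n - 1 →
      ((2 * n - l + 1 : ℕ) : Cardinal) ≤
        SmoothForms.bettiNumber (EuclideanSpace ℝ (Fin (4 * n))) M (2 * l)) := by
  obtain ⟨S⟩ := h
  have hn : Module.finrank ℝ (EuclideanSpace ℝ (Fin (4 * n))) = 4 * n := finrank_euclideanSpace_fin
  refine ⟨fun k _ hk => ?_, fun l hl hl' => ?_⟩
  -- Both exponents run over `0, …, k`, with `p = k`.
  · exact S.le_bettiNumber hn (q := 0) (by omega) (by omega)
  -- Above the middle degree both exponents must stay `≤ n`, so they run over `l - n, …, n`, with `p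
  -- = 2 * n - l`.
  · exact S.le_bettiNumber hn (q := l - n) (by omega) (by omega)
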